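/- **Setting.** Let $\mathcal D$ be a set of possible observations. A database is a finite multiset $D$ of elements of $\mathcal D$, and $D\sim D'$ (neighbouring) means that one of them arises from the other by adding one observation. A randomized mechanism $\mathcal M$ assigns to each database a probability law $\mathcal M(D)$. It is *$(\epsilon,\delta)$-differentially private* if $\Pr[\mathcal M(D)\in S]\le e^{\epsilon}\Pr[\mathcal M(D')\in S]+\delta$ for all $D\sim D'$ and all measurable $S$. It satisfies *$\rho$-zCDP* if for all $D\sim D'$ the law $\mathcal M(D)$ is absolutely continuous with respect to $\mathcal M(D')$ and, with $Z(o)=\log\frac{d\mathcal M(D)}{d\mathcal M(D')}(o)$, $\mathbb E_{o\sim\mathcal M(D)}\big[e^{(\alpha-1)Z(o)}\big]\le e^{(\alpha-1)\alpha\rho}$ for all $\alpha\in(1,\infty)$. Let $\ell(w;d)\ge 0$ ($w\in\mathbb R^p$, $d\in\mathcal D$) be a nonnegative loss, Borel measurable in $w$, and let $\nabla\ell(\cdot;d)$ be a Borel measurable map that equals the gradient of $\ell(\cdot;d)$ wherever the latter is differentiable (e.g. a choice of subgradient elsewhere). Let $C_{\mathsf{obj}},C_{\mathsf{grad}},\rho_{\mathsf{nmax}},\rho_{\mathsf{ng}},\gamma>0$,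 let $w_0\in\mathbb R^p$, and let $\Phi=(\alpha_0,\dots,\alpha_m)$, $m\ge1$, be real candidate step sizes; $\Phi$ may be fixed, or be re-adjusted at each iteration as a function of the step-size indices selected in earlier iterations. Put $$f(w;D)=\sum_{d\in D}\min(\ell(w;d),C_{\mathsf{obj}}),\qquad g(w;D)=\sum_{d\in D}\frac{\nabla\ell(w;d)}{\max(1,\|\nabla\ell(w;d)\|_2/C_{\mathsf{grad}})} .$$ $\mathrm{NoisyMax}(v_0,\dots,v_m;\Delta,\epsilon)$ adds independent Laplace noise of mean $0$ and scale $\Delta/\epsilon$ to each $v_j$ and returns the index of the largest result (the least such index in case of a tie). **Algorithm DP-AGD** with total budget $\rho$, on the database $D$. Start with $w=w_0$. While $\rho>0$: 1. Set $g\leftarrow g(w;D)$, draw $\tilde g\sim N\big(g,\tfrac{C_{\mathsf{grad}}^2}{2\rho_{\mathsf{ng}}}I\big)$, set $\rho\leftarrow\rho-\rho_{\mathsf{ng}}$ and $\tilde g\leftarrow\tilde g/\|\tilde g\|_2$ (with $0/0=0$). 2. Set $i\leftarrow 0$. While $i=0$: set $\rho\leftarrow\rho-\rho_{\mathsf{nmax}}$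 and $i\leftarrow\mathrm{NoisyMax}\big((-f(w-\alpha_j\tilde g;D))_{0\le j\le m};\,C_{\mathsf{obj}},\sqrt{2\rho_{\mathsf{nmax}}}\big)$. * If $i>0$: if $\rho>0$, set $w\leftarrow w-\alpha_i\tilde g$; otherwise leave $w$ unchanged. * If $i=0$: set $\rho_{\mathsf{old}}\leftarrow\rho_{\mathsf{ng}}$ and $\rho_{\mathsf{ng}}\leftarrow(1+\gamma)\rho_{\mathsf{ng}}$, draw $\tilde g_2\sim N\big(g,\tfrac{C_{\mathsf{grad}}^2}{2(\rho_{\mathsf{ng}}-\rho_{\mathsf{old}})}I\big)$, set $\tilde g\leftarrow\big(\rho_{\mathsf{old}}\tilde g+(\rho_{\mathsf{ng}}-\rho_{\mathsf{old}})\tilde g_2\big)/\rho_{\mathsf{ng}}$ and $\rho\leftarrow\rho-(\rho_{\mathsf{ng}}-\rho_{\mathsf{old}})$. All random draws are independent given the past; the increased value of $\rho_{\mathsf{ng}}$ is kept in later iterations. When the outer loop ends, only $w$ is released. **Theorem.** Let $\delta_{\mathsf{tot}}>0$, $\epsilon_{\mathsf{tot}}\in\mathbb R$ and $\rho\ge0$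 satisfy $\epsilon_{\mathsf{tot}}\ge\rho+2\sqrt{\rho\log(1/\delta_{\mathsf{tot}})}$ (the square root being read as $0$ if $\delta_{\mathsf{tot}}>1$). Then DP-AGD with total budget $\rho$ terminates almost surely on every database, so that its output has a probability law, and it satisfies $\rho$-zCDP and $(\epsilon_{\mathsf{tot}},\delta_{\mathsf{tot}})$-differential privacy. -/

import Mathlib

open MeasureTheory ProbabilityTheory

noncomputable section

namespace DPAGD

/-! ### Privacy notions -/

/-- Databases are finite multisets of observations; neighbours differ by adding or removing one
observation. -/
def Neighbor {𝒟 : Type*} (D D' : Multiset 𝒟) : Prop :=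
  ∃ d, D' = d ::ₘ D ∨ D = d ::ₘ D'

/-- `(ε, δ)`-differential privacy of a randomized mechanism, given by its output laws. -/
def IsDP {𝒟 Y : Type*} [MeasurableSpace Y] (M : Multiset 𝒟 → Measure Y) (ε δ : ℝ) : Prop :=
  ∀ D D', Neighbor D D' → ∀ S, MeasurableSet S →
    M D S ≤ ENNReal.ofReal (Real.exp ε) * M D' S + ENNReal.ofReal δ

/-- `ρ`-zCDP. With the privacy loss `Z = log (dP/dQ)`, the integral is `𝔼_P[exp ((α - 1) Z)]`,
i.e. `exp ((α - 1) D_α(P ‖ Q))` for the Rényi divergence `D_α`, which is infinite unless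
`P ≪ Q`. -/
def IsZCDP {𝒟 Y : Type*} [MeasurableSpace Y] (M : Multiset 𝒟 → Measure Y) (ρ : ℝ) : Prop :=
  ∀ D D', Neighbor D D' → M D ≪ M D' ∧ ∀ α : ℝ, 1 < α →
    ∫⁻ y, ((M D).rnDeriv (M D') y) ^ (α - 1) ∂(M D) ≤
      ENNReal.ofReal (Real.exp ((α - 1) * α * ρ))

/-! ### Noise distributions and NoisyMax -/

/-- The Laplace distribution with mean `0` and scale `b` (for `b > 0`). -/
def laplace (b : ℝ) : Measure ℝ :=
  volume.withDensity fun x => ENNReal.ofReal (Real.exp (-|x| / b) / (2 * b))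

/-- The weight space `ℝ^p` with the Euclidean norm. -/
abbrev E (p : ℕ) := EuclideanSpace ℝ (Fin p)

/-- `N(μ, v I)`. -/
def gaussian {p : ℕ} (μ : E p) (v : ℝ) : Measure (E p) :=
  multivariateGaussian μ (v • (1 : Matrix (Fin p) (Fin p) ℝ))

/-- The (least) index of a largest entry. -/
def argmax {m : ℕ} (v : Fin (m + 1) → ℝ) : Fin (m + 1) :=
  (Finset.univ.filter fun j => ∀ k, v k ≤ v j).min' (by
    obtain ⟨j, hj⟩ := Finite.exists_max v
    exact ⟨j, by simpa using hj⟩)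

/-- NoisyMax with scores `v`, sensitivity `Δ` and pure budget `ε`: the law of the index of the
largest score after adding independent Laplace noise of scale `Δ / ε` to each score. -/
def noisyMax {m : ℕ} (v : Fin (m + 1) → ℝ) (Δ ε : ℝ) : Measure (Fin (m + 1)) :=
  (Measure.pi fun _ => laplace (Δ / ε)).map fun z => argmax (v + z)

/-! ### Probabilistic while loops -/

open scoped Classical in
/-- The (sub-probability) law of the final state of `while c do body`, started in `s`, on the
event that the body is executed exactly `n` times. -/
def whileExit {σ : Type*} [MeasurableSpace σ] (c : σ → Prop) (body : σ → Measure σ) :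
    ℕ → σ → Measure σ
  | 0, s => if c s then 0 else Measure.dirac s
  | n + 1, s => if c s then (body s).bind (whileExit c body n) else 0

/-- The law of the final state of `while c do body`, started in `s`; its missing mass is the
probability that the loop runs forever. -/
def whileLoop {σ : Type*} [MeasurableSpace σ] (c : σ → Prop) (body : σ → Measure σ) (s : σ) :
    Measure σ :=
  Measure.sum fun n => whileExit c body n s

/-! ### The algorithm -/

/-- Indices of the step sizes selected in the previous iterations, oldest first. -/
abbrev History (m : ℕ) := List (Fin (m + 1))

instance (m : ℕ) : MeasurableSpace (History m) := ⊤

/-- Inputs of the algorithm other than the database and the total budget. There are `m + 1`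
candidate step sizes; they may be re-adjusted at every iteration as a function of the step-size
indices selected so far (a constant `Φ` is a fixed list of step sizes). -/
structure Params (𝒟 : Type*) (p m : ℕ) where
  /-- loss function `ℓ(w; d)` -/
  loss : 𝒟 → E p → ℝ
  /-- gradient `∇ℓ(w; d)` -/
  grad : 𝒟 → E p → E p
  /-- budget of one call of NoisyMax -/
  ρnmax : ℝ
  /-- initial budget of one gradient measurement -/
  ρng : ℝ
  /-- budget increase rate -/
  γ : ℝ
  /-- clipping threshold of the objective -/
  Cobj : ℝ
  /-- clipping threshold of the gradients -/
  Cgrad : ℝ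
  /-- initial weights -/
  w₀ : E p
  /-- candidate step sizes -/
  Φ : History m → Fin (m + 1) → ℝ

variable {𝒟 : Type*} {p m : ℕ}

/-- The clipped objective `∑ᵢ min (ℓ(w; dᵢ)) C_obj`. -/
def clippedObj (A : Params 𝒟 p m) (D : Multiset 𝒟) (w : E p) : ℝ :=
  (D.map fun d => min (A.loss d w) A.Cobj).sum

/-- The sum of clipped gradients `∑ᵢ ∇ℓ(w; dᵢ) / max(1, ‖∇ℓ(w; dᵢ)‖ / C_grad)`. -/
def clippedGrad (A : Params 𝒟 p m) (D : Multiset 𝒟) (w : E p) : E p :=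
  (D.map fun d => (max 1 (‖A.grad d w‖ / A.Cgrad))⁻¹ • A.grad d w).sum

/-- Gradient averaging: a fresh measurement of `g` with budget `ρH - ρold`, averaged with the
previous estimate `g'`. -/
def gradAvg (ρold ρH : ℝ) (g g' : E p) (C : ℝ) : Measure (E p) :=
  (gaussian g (C ^ 2 / (2 * (ρH - ρold)))).map fun g₂ =>
    ρH⁻¹ • (ρold • g' + (ρH - ρold) • g₂)

/-- State of the inner loop: `(w, history, g, g̃, ρ_ng, ρ, i)`. -/
abbrev InnerState (p m : ℕ) := E p × History m × E p × E p × ℝ × ℝ × Fin (m + 1)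

/-- State of the outer loop: `(w, history, ρ_ng, ρ)`. -/
abbrev OuterState (p m : ℕ) := E p × History m × ℝ × ℝ

open scoped Classical in
/-- Body of the inner loop: deduct `ρ_nmax` and select an index `i` by NoisyMax. If `i > 0`,
update the weights provided that the remaining budget is positive. If `i = 0`, raise `ρ_ng` by the
factor `1 + γ`, improve the gradient estimate and deduct the increase. -/
def innerBody (A : Params 𝒟 p m) (D : Multiset 𝒟) : InnerState p m → Measure (InnerState p m)
  | (w, h, g, g', ρng, ρ, _) =>
    let ρ₁ := ρ - A.ρnmax
    (noisyMax (fun j => -clippedObj A D (w - A.Φ h j • g')) A.Cobj (√(2 * A.ρnmax))).bind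
      fun i =>
        if 0 < i then
          if 0 < ρ₁ then Measure.dirac (w - A.Φ h i • g', h ++ [i], g, g', ρng, ρ₁, i)
          else Measure.dirac (w, h, g, g', ρng, ρ₁, i)
        else
          let ρng₁ := (1 + A.γ) * ρng
          (gradAvg ρng ρng₁ g g' A.Cgrad).bind fun g'₁ =>
            Measure.dirac (w, h, g, g'₁, ρng₁, ρ₁ - (ρng₁ - ρng), i)

/-- The inner loop, repeated while `i = 0`. -/
def innerLoop (A : Params 𝒟 p m) (D : Multiset 𝒟) : InnerState p m → Measure (InnerState p m) :=
  whileLoop (fun (_, _, _, _, _, _, i) => i = 0) (innerBody A D)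

/-- Body of the outer loop: measure the clipped gradient with budget `ρ_ng`, deduct `ρ_ng`,
normalize the estimate, and run the inner loop. -/
def outerBody (A : Params 𝒟 p m) (D : Multiset 𝒟) : OuterState p m → Measure (OuterState p m)
  | (w, h, ρng, ρ) =>
    let g := clippedGrad A D w
    (gaussian g (A.Cgrad ^ 2 / (2 * ρng))).bind fun g' =>
      (innerLoop A D (w, h, g, ‖g'‖⁻¹ • g', ρng, ρ - ρng, 0)).bind
        fun (w₁, h₁, _, _, ρng₁, ρ₁, _) => Measure.dirac (w₁, h₁, ρng₁, ρ₁)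

/-- The output law of DP-AGD on the database `D` with total zCDP budget `ρ`: run the outer loop
while the remaining budget is positive, and release the final weights only. -/
def dpAGD (A : Params 𝒟 p m) (ρ : ℝ) (D : Multiset 𝒟) : Measure (E p) :=
  (whileLoop (fun (_, _, _, ρ') => 0 < ρ') (outerBody A D) (A.w₀, [], A.ρng, ρ)).map Prod.fst

end DPAGD

end

/-! The remaining budget is part of the state, so privacy follows by induction on it. Suppose the
runs on two neighbouring databases are continued from the same state, up to the stored exact
gradient, with budget `ρ` left. Then the released laws have Rényi divergence of order `α` at most `α
* max ρ 0`. Given the past, each noisy step is a fixed mechanism costing at most what is deducted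
for it, and the claim for the rest of the run holds from every next state. Composition therefore
adds up to `ρ`, although the number of steps is random and depends on the data.

Steps may overdraw the budget. This is harmless: weights change only if the budget is still positive
after a selection is paid for. Once it is at most `ρnmax` the weights are frozen, and the output is
a point mass that does not depend on the database (`Admissible.innerOutput_of_le`). The unpaid steps
never reach the output.

Rényi bounds are used in Hölder-dual form, which composes along `bind` without densities of
composite laws (`RenyiBound.bind`). The costs of single steps are `renyiBound_gaussian` and, for
NoisyMax, `noisyMax_singleton_le` combined with `lintegral_exp_rpow_le`.

Termination: clipping confines the scores to a bounded interval, so each selection ends the inner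
loop with probability bounded below. Every outer pass spends at least `ρnmax`. That the outputs have
mass one is carried through the same induction by `RenyiClose`. Finally,
`RenyiBound.lintegral_rnDeriv_rpow_le` and `measure_le_of_renyiBound` turn dual bounds into zCDP and
approximate differential privacy. -/

noncomputable section

namespace DPAGD

open scoped ENNReal

/-! ### Rényi bounds in dual form -/

/-- The Rényi divergence bound `D_α(P ‖ Q) ≤ α ρ` in its dual (Hölder) form: integration against
`P` is bounded on `L^q(Q)`, where `q = α / (α - 1)`, with norm at most `exp ((α - 1) ρ)`. -/
def RenyiBound {Y : Type*} [MeasurableSpace Y] (α ρ : ℝ) (P Q : Measure Y) : Prop :=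
  ∀ f : Y → ℝ≥0∞, Measurable f →
    ∫⁻ y, f y ∂P ≤
      ENNReal.ofReal (Real.exp ((α - 1) * ρ)) *
        (∫⁻ y, f y ^ (α / (α - 1)) ∂Q) ^ ((α - 1) / α)

section RenyiBound

variable {X Y : Type*} [MeasurableSpace X] [MeasurableSpace Y] {α ρ : ℝ} {P Q : Measure Y}

theorem RenyiBound.mono {ρ' : ℝ} (hα : 1 < α) (h : RenyiBound α ρ P Q) (hρ : ρ ≤ ρ') :
    RenyiBound α ρ' P Q := fun f hf =>
  (h f hf).trans <| mul_le_mul_left (ENNReal.ofReal_le_ofReal <| Real.exp_le_exp.2 <|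
    mul_le_mul_of_nonneg_left hρ (by linarith)) _

theorem RenyiBound.map {g : Y → X} (h : RenyiBound α ρ P Q) (hg : Measurable g) :
    RenyiBound α ρ (P.map g) (Q.map g) := fun f hf => by
  rw [lintegral_map hf hg, lintegral_map (hf.pow_const _) hg]
  exact h _ (hf.comp hg)

/-- Adaptive composition. After the bound for `K y`, the bound for `P` is applied to the `L^q(K' y)`
norm of `f` as a function of `y`; its `q`-th power is the inner integral, so the iterated norm
collapses to the norm under the composite law. -/
theorem RenyiBound.bind {a b : ℝ} {K K' : Y → Measure X} (hα : 1 < α) (h : RenyiBound α a P Q)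
    (hK : Measurable K) (hK' : Measurable K') (hKK' : ∀ y, RenyiBound α b (K y) (K' y)) :
    RenyiBound α (a + b) (P.bind K) (Q.bind K') := fun f hf => by
  have h0 : 0 < α - 1 := by linarith
  have h1 : 0 < α := by linarith
  have hq : (α - 1) / α * (α / (α - 1)) = 1 := by field_simp
  have hmeas : Measurable fun y => ∫⁻ x, f x ^ (α / (α - 1)) ∂K' y :=
    (Measure.measurable_lintegral (hf.pow_const _)).comp hK'
  rw [Measure.lintegral_bind hK.aemeasurable hf.aemeasurable,
    Measure.lintegral_bind hK'.aemeasurable (hf.pow_const _).aemeasurable]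
  refine (lintegral_mono fun y => hKK' y f hf).trans ?_
  rw [lintegral_const_mul _ (hmeas.pow_const _), mul_add, Real.exp_add,
    ENNReal.ofReal_mul (Real.exp_nonneg _), mul_comm (ENNReal.ofReal (Real.exp ((α - 1) * a))),
    mul_assoc]
  refine mul_le_mul_right ((h _ (hmeas.pow_const _)).trans_eq ?_) _
  simp_rw [← ENNReal.rpow_mul, hq, ENNReal.rpow_one]

theorem RenyiBound.refl (hα : 1 < α) (hρ : 0 ≤ ρ) (P : Measure Y) [IsProbabilityMeasure P] :
    RenyiBound α ρ P P := by
  refine RenyiBound.mono (ρ := 0) hα (fun f hf => ?_) hρ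
  have h0 : 0 < α - 1 := by linarith
  have hc : (α / (α - 1)).HolderConjugate α := by
    rw [Real.holderConjugate_iff]
    refine ⟨by rw [lt_div_iff₀ h0]; linarith, by field_simp; ring⟩
  have := ENNReal.lintegral_mul_le_Lp_mul_Lq P hc hf.aemeasurable
    (aemeasurable_const (b := (1 : ℝ≥0∞)))
  simpa [one_div_div] using this

/-- Hölder's inequality with exponents `α` and `α / (α - 1)`. This is how concrete mechanisms enter
the dual formulation. -/
theorem RenyiBound.withDensity {r : Y → ℝ≥0∞} (hα : 1 < α) (hr : Measurable r)
    (h : ∫⁻ y, r y ^ α ∂Q ≤ ENNReal.ofReal (Real.exp (α * (α - 1) * ρ))) :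
    RenyiBound α ρ (Q.withDensity r) Q := fun f hf => by
  have h0 : 0 < α - 1 := by linarith
  have hc : α.HolderConjugate (α / (α - 1)) := by
    rw [Real.holderConjugate_iff]
    refine ⟨hα, by field_simp; ring⟩
  rw [lintegral_withDensity_eq_lintegral_mul _ hr hf]
  refine (ENNReal.lintegral_mul_le_Lp_mul_Lq Q hc hr.aemeasurable hf.aemeasurable).trans ?_
  rw [one_div_div]
  refine mul_le_mul_left ((ENNReal.rpow_le_rpow h (by positivity)).trans_eq ?_) _
  rw [ENNReal.ofReal_rpow_of_pos (Real.exp_pos _), ← Real.exp_mul]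
  congr 2
  field_simp

theorem RenyiBound.measure_le (hα : 1 < α) (h : RenyiBound α ρ P Q) {s : Set Y}
    (hs : MeasurableSet s) :
    P s ≤ ENNReal.ofReal (Real.exp ((α - 1) * ρ)) * Q s ^ ((α - 1) / α) := by
  have h1 : 0 < α - 1 := by linarith
  have h2 : 0 < α / (α - 1) := by positivity
  have := h (s.indicator 1) (measurable_one.indicator hs)
  have e : ∀ y, s.indicator (1 : Y → ℝ≥0∞) y ^ (α / (α - 1)) = s.indicator 1 y := fun y => by
    by_cases hy : y ∈ s <;> simp [hy, h2]
  simpa only [e, lintegral_indicator_one hs] using this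

theorem RenyiBound.absolutelyContinuous (hα : 1 < α) (h : RenyiBound α ρ P Q) : P ≪ Q := by
  refine Measure.AbsolutelyContinuous.mk fun s hs h0 => ?_
  have h1 : 0 < α - 1 := by linarith
  have := h.measure_le hα hs
  rw [h0, ENNReal.zero_rpow_of_pos (by positivity), mul_zero] at this
  exact le_antisymm this zero_le

/-- A self-improving inequality: `x ≤ c x^(1 - 1/α)` implies `x ≤ c^α` for finite `x`. -/
theorem le_rpow_of_le_mul_rpow {x c : ℝ≥0∞} (hα : 1 < α) (hx : x ≠ ∞)
    (h : x ≤ c * x ^ ((α - 1) / α)) : x ≤ c ^ α := by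
  have h1 : 0 < α := by linarith
  rcases eq_or_ne x 0 with rfl | hx0
  · exact zero_le
  have e : x = x ^ (1 / α) * x ^ ((α - 1) / α) := by
    rw [← ENNReal.rpow_add _ _ hx0 hx]
    conv_lhs => rw [← ENNReal.rpow_one x]
    congr 1; field_simp; ring
  have hp : x ^ ((α - 1) / α) ≠ 0 := by
    simp [hx0, hx]
  have hp' : x ^ ((α - 1) / α) ≠ ∞ := by
    refine ENNReal.rpow_ne_top_of_nonneg (div_nonneg (by linarith) h1.le) hx
  have : x ^ (1 / α) ≤ c := by
    exact (ENNReal.mul_le_mul_iff_left hp hp').1 (e.symm.trans_le h)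
  calc x = (x ^ (1 / α)) ^ α := by
        rw [← ENNReal.rpow_mul, one_div_mul_cancel h1.ne', ENNReal.rpow_one]
    _ ≤ c ^ α := ENNReal.rpow_le_rpow this h1.le

/-- The extremal test function is the `(α - 1)`-th power of the density `r`. Truncating at `n` keeps
`∫ min(r, n)^α dQ` finite, so the dual bound can be divided by a power of that same integral;
monotone convergence removes the truncation. -/
theorem RenyiBound.lintegral_rnDeriv_rpow_le [IsProbabilityMeasure P] [IsProbabilityMeasure Q]
    (hα : 1 < α) (h : RenyiBound α ρ P Q) :
    ∫⁻ y, P.rnDeriv Q y ^ (α - 1) ∂P ≤ ENNReal.ofReal (Real.exp ((α - 1) * α * ρ)) := by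
  have h0 : 0 < α - 1 := by linarith
  have h1 : 0 < α := by linarith
  have hac := h.absolutelyContinuous hα
  set r := P.rnDeriv Q
  have hrm : Measurable r := Measure.measurable_rnDeriv _ _
  set c := ENNReal.ofReal (Real.exp ((α - 1) * ρ)) with hc
  have hcα : c ^ α = ENNReal.ofReal (Real.exp ((α - 1) * α * ρ)) := by
    rw [hc, ENNReal.ofReal_rpow_of_pos (Real.exp_pos _), ← Real.exp_mul]
    congr 2; ring
  have key : ∀ n : ℕ, ∫⁻ y, min (r y) n ^ (α - 1) ∂P ≤ c ^ α := fun n => by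
    have hgm : Measurable fun y => min (r y) (n : ℝ≥0∞) := hrm.min measurable_const
    have hle := h _ (hgm.pow_const (α - 1))
    have e : (α - 1) * (α / (α - 1)) = α := by field_simp
    simp_rw [← ENNReal.rpow_mul, e] at hle
    set I := ∫⁻ y, min (r y) (n : ℝ≥0∞) ^ α ∂Q
    have hIfin : I ≠ ∞ := by
      refine ((lintegral_mono fun y => ENNReal.rpow_le_rpow (min_le_right (r y) (n : ℝ≥0∞))
        h1.le).trans_lt ?_).ne
      rw [lintegral_const, measure_univ, mul_one]
      exact (ENNReal.rpow_ne_top_of_nonneg h1.le (ENNReal.natCast_ne_top n)).lt_top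
    have hIle : I ≤ ∫⁻ y, min (r y) (n : ℝ≥0∞) ^ (α - 1) ∂P := by
      rw [← lintegral_rnDeriv_mul hac (hgm.pow_const (α - 1)).aemeasurable]
      refine lintegral_mono fun y => ?_
      calc min (r y) (n : ℝ≥0∞) ^ α
          = min (r y) (n : ℝ≥0∞) ^ (1 : ℝ) * min (r y) (n : ℝ≥0∞) ^ (α - 1) := by
            rw [← ENNReal.rpow_add_of_nonneg _ _ zero_le_one h0.le]; congr 1; ring
        _ ≤ _ := by
            rw [ENNReal.rpow_one]
            exact mul_le_mul_left (min_le_left _ _) _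
    have hIc := le_rpow_of_le_mul_rpow hα hIfin (hIle.trans hle)
    refine hle.trans ((mul_le_mul_right (ENNReal.rpow_le_rpow hIc (by positivity)) _).trans_eq ?_)
    rw [← ENNReal.rpow_mul, ← hc]
    calc c * c ^ (α * ((α - 1) / α)) = c ^ (1 : ℝ) * c ^ (α - 1) := by
          rw [ENNReal.rpow_one, mul_div_cancel₀ _ h1.ne']
      _ = c ^ α := by
          rw [← ENNReal.rpow_add_of_nonneg _ _ zero_le_one h0.le]; congr 1; ring
  rw [← hcα]
  refine le_of_tendsto' (lintegral_tendsto_of_tendsto_of_monotone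
    (f := fun (n : ℕ) y => min (r y) (n : ℝ≥0∞) ^ (α - 1)) (F := fun y => r y ^ (α - 1))
    (fun n => ((hrm.min measurable_const).pow_const _).aemeasurable) ?_ ?_) key
  · refine ae_of_all _ fun y m n hmn => ENNReal.rpow_le_rpow ?_ h0.le
    exact min_le_min_left _ (by exact_mod_cast hmn)
  · filter_upwards [hac.ae_le (Measure.rnDeriv_lt_top P Q)] with y hy
    obtain ⟨N, hN⟩ := ENNReal.exists_nat_gt hy.ne
    refine tendsto_const_nhds.congr' ?_
    filter_upwards [Filter.eventually_ge_atTop N] with n hn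
    rw [min_eq_left (hN.le.trans (by exact_mod_cast hn))]

/-- Conversion of Rényi bounds into an additive-multiplicative bound. -/
theorem measure_le_of_renyiBound [IsProbabilityMeasure P] [IsProbabilityMeasure Q] {ε δ : ℝ}
    (h : ∀ α, 1 < α → RenyiBound α ρ P Q) (hδ : 0 < δ) (hρ : 0 < ρ)
    (hε : ρ + 2 * √(ρ * Real.log (1 / δ)) ≤ ε) {s : Set Y} (hs : MeasurableSet s) :
    P s ≤ ENNReal.ofReal (Real.exp ε) * Q s + ENNReal.ofReal δ := by
  rcases le_or_gt 1 δ with h1 | h1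
  · exact (prob_le_one.trans (by simpa using h1)).trans le_add_self
  -- If the claim fails without `δ`, then `Q s` is below `exp (-ε) * P s`, and the Rényi bound
  -- becomes a self-bound on `P s`.
  rcases le_or_gt (P s) (ENNReal.ofReal (Real.exp ε) * Q s) with h2 | h2
  · exact h2.trans le_self_add
  have hlog : 0 < Real.log (1 / δ) := Real.log_pos (by rw [lt_div_iff₀ hδ]; linarith)
  have hsq : 0 < √(ρ * Real.log (1 / δ)) := Real.sqrt_pos.2 (by positivity)
  have hερ : 0 < ε - ρ := by linarith
  -- The minimiser of `(α - 1) * (α * ρ - ε)`, with minimum `-(ε - ρ)² / (4 * ρ)`.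
  set α := 1 + (ε - ρ) / (2 * ρ) with hα'
  have hα : 1 < α := by
    have : 0 < (ε - ρ) / (2 * ρ) := by positivity
    linarith
  have h0 : 0 < α - 1 := by linarith
  have hα0 : 0 < α := by linarith
  have hQ : Q s ≤ ENNReal.ofReal (Real.exp (-ε)) * P s := by
    calc Q s = ENNReal.ofReal (Real.exp (-ε)) * (ENNReal.ofReal (Real.exp ε) * Q s) := by
          rw [← mul_assoc, ← ENNReal.ofReal_mul (Real.exp_nonneg _), ← Real.exp_add]; simp
      _ ≤ _ := mul_le_mul_right h2.le _
  have h3 := (h α hα).measure_le hα hs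
  have h4 := h3.trans (mul_le_mul_right (ENNReal.rpow_le_rpow hQ
    (by positivity : 0 ≤ (α - 1) / α)) _)
  rw [ENNReal.mul_rpow_of_nonneg _ _ (by positivity), ← mul_assoc] at h4
  refine (le_rpow_of_le_mul_rpow hα (measure_ne_top _ _) h4).trans (le_trans ?_ le_add_self)
  rw [ENNReal.ofReal_rpow_of_pos (Real.exp_pos _), ← Real.exp_mul,
    ← ENNReal.ofReal_mul (Real.exp_nonneg _), ← Real.exp_add,
    ENNReal.ofReal_rpow_of_pos (Real.exp_pos _), ← Real.exp_mul]
  refine ENNReal.ofReal_le_ofReal ?_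
  rw [← Real.le_log_iff_exp_le hδ]
  have e : ((α - 1) * ρ + -ε * ((α - 1) / α)) * α = (α - 1) * (α * ρ - ε) := by
    field_simp; ring
  have e2 : (α - 1) * (α * ρ - ε) = -((ε - ρ) ^ 2 / (4 * ρ)) := by
    rw [hα']; field_simp; ring
  rw [e, e2, neg_le, ← Real.log_inv, ← one_div, le_div_iff₀ (by positivity)]
  have hss := Real.sq_sqrt (show 0 ≤ ρ * Real.log (1 / δ) by positivity)
  nlinarith

end RenyiBound

/-! ### Measurable families of measures -/

section Kernels

variable {X Y Z : Type*} [MeasurableSpace X] [MeasurableSpace Y] [MeasurableSpace Z]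

theorem measurable_bind_param {κ : X → Measure Y} {K : X → Y → Measure Z} (hκ : Measurable κ)
    (hprob : ∀ x, IsProbabilityMeasure (κ x)) (hK : Measurable (Function.uncurry K)) :
    Measurable fun x => (κ x).bind (K x) := by
  refine Measure.measurable_of_measurable_coe _ fun s hs => ?_
  have h (x) : (κ x).bind (K x) s = ∫⁻ y, K x y s ∂κ x :=
    Measure.bind_apply hs (hK.comp measurable_prodMk_left).aemeasurable
  simp_rw [h]
  let k : Kernel X Y := ⟨κ, hκ⟩
  have : IsMarkovKernel k := ⟨hprob⟩
  exact Measurable.lintegral_kernel_prod_right (κ := k) (f := fun x y => K x y s)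
    ((Measure.measurable_coe hs).comp hK)

theorem measurable_map_param (μ : Measure Y) [SFinite μ] {F : X → Y → Z}
    (hF : Measurable (Function.uncurry F)) : Measurable fun x => μ.map (F x) := by
  refine Measure.measurable_of_measurable_coe _ fun s hs => ?_
  have h (x) : μ.map (F x) s = μ (F x ⁻¹' s) :=
    Measure.map_apply (hF.comp measurable_prodMk_left) hs
  simp_rw [h]
  exact measurable_measure_prodMk_left (hF hs)

theorem isProbabilityMeasure_bind {μ : Measure X} [IsProbabilityMeasure μ] {K : X → Measure Y}
    (hK : Measurable K) (h : ∀ x, IsProbabilityMeasure (K x)) :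
    IsProbabilityMeasure (μ.bind K) :=
  ⟨by rw [Measure.bind_apply MeasurableSet.univ hK.aemeasurable]; simp⟩

theorem ae_bind_of_forall {μ : Measure X} {K : X → Measure Y} (hK : Measurable K) {p : Y → Prop}
    (hp : MeasurableSet {y | p y}) (h : ∀ᵐ x ∂μ, ∀ᵐ y ∂K x, p y) : ∀ᵐ y ∂μ.bind K, p y := by
  rw [ae_iff]
  have hp' : MeasurableSet {y | ¬ p y} := hp.compl
  rw [Measure.bind_apply hp' hK.aemeasurable, lintegral_eq_zero_iff
    (Measure.measurable_measure.1 hK _ hp')]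
  filter_upwards [h] with x hx using ae_iff.1 hx

/-- A probability measure averages a family that is almost surely constant to that constant. -/
theorem bind_eq_of_forall_eq {μ : Measure X} [IsProbabilityMeasure μ] {K : X → Measure Y}
    {ν : Measure Y} (h : ∀ᵐ x ∂μ, K x = ν) : μ.bind K = ν := by
  rw [Measure.bind_congr_right (g := fun _ => ν) h, Measure.bind_const, measure_univ, one_smul]

end Kernels

/-! ### While loops -/

section WhileLoop

variable {σ : Type*} [MeasurableSpace σ] {c : σ → Prop} {body : σ → Measure σ}

theorem whileExit_zero_of_not {s : σ} (hs : ¬ c s) : whileExit c body 0 s = Measure.dirac s :=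
  if_neg hs

theorem whileExit_zero_of {s : σ} (hs : c s) : whileExit c body 0 s = 0 := if_pos hs

theorem whileExit_succ_of {s : σ} (hs : c s) (n : ℕ) :
    whileExit c body (n + 1) s = (body s).bind (whileExit c body n) := if_pos hs

theorem whileExit_succ_of_not {s : σ} (hs : ¬ c s) (n : ℕ) :
    whileExit c body (n + 1) s = 0 := if_neg hs

theorem measurable_whileExit (hc : MeasurableSet {s | c s}) (hb : Measurable body) (n : ℕ) :
    Measurable (whileExit c body n) := by
  classical
  induction n with
  | zero => exact Measurable.ite hc measurable_const Measure.measurable_dirac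
  | succ n ih => exact Measurable.ite hc ((Measure.measurable_bind' ih).comp hb) measurable_const

theorem measurable_whileLoop (hc : MeasurableSet {s | c s}) (hb : Measurable body) :
    Measurable (whileLoop c body) := by
  refine Measure.measurable_of_measurable_coe _ fun s hs => ?_
  simp_rw [whileLoop, Measure.sum_apply _ hs]
  exact Measurable.tsum fun n =>
    Measure.measurable_measure.1 (measurable_whileExit hc hb n) _ hs

theorem whileLoop_of_not {s : σ} (hs : ¬ c s) : whileLoop c body s = Measure.dirac s := by
  ext t ht
  rw [whileLoop, Measure.sum_apply _ ht, tsum_eq_single 0, whileExit_zero_of_not hs]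
  intro n hn
  obtain ⟨k, rfl⟩ := Nat.exists_eq_succ_of_ne_zero hn
  simp [whileExit_succ_of_not hs]

/-- The unfolding equation of the loop: when `c s` holds, the term for zero iterations vanishes and
the rest of the series shifts by one. -/
theorem whileLoop_of (hc : MeasurableSet {s | c s}) (hb : Measurable body) {s : σ} (hs : c s) :
    whileLoop c body s = (body s).bind (whileLoop c body) := by
  ext t ht
  rw [Measure.bind_apply ht (measurable_whileLoop hc hb).aemeasurable]
  simp_rw [whileLoop, Measure.sum_apply _ ht]
  rw [lintegral_tsum fun n => (Measure.measurable_measure.1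
    (measurable_whileExit hc hb n) _ ht).aemeasurable, tsum_eq_zero_add' ENNReal.summable,
    whileExit_zero_of hs, Measure.coe_zero, Pi.zero_apply, zero_add]
  congr 1 with n
  rw [whileExit_succ_of hs, Measure.bind_apply ht (measurable_whileExit hc hb n).aemeasurable]

/-- A property preserved by the body of a loop holds almost surely at its exit, together with the
negated loop condition. -/
theorem ae_whileLoop (hc : MeasurableSet {s | c s}) (hb : Measurable body) {p : σ → Prop}
    (hp : MeasurableSet {s | p s}) (hinv : ∀ s, p s → c s → ∀ᵐ t ∂body s, p t) {s : σ}
    (hs : p s) : ∀ᵐ t ∂whileLoop c body s, p t ∧ ¬ c t := by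
  have hmeas : MeasurableSet {t | p t ∧ ¬ c t} := hp.inter hc.compl
  rw [whileLoop, Measure.ae_sum_iff]
  intro n
  induction n generalizing s with
  | zero =>
    by_cases h : c s
    · rw [whileExit_zero_of h]; simp
    · rw [whileExit_zero_of_not h, ae_dirac_iff hmeas]; exact ⟨hs, h⟩
  | succ n ih =>
    by_cases h : c s
    · rw [whileExit_succ_of h]
      refine ae_bind_of_forall (measurable_whileExit hc hb n) hmeas ?_
      filter_upwards [hinv s hs h] with t ht using ih ht
    · rw [whileExit_succ_of_not h]; simp

/-- First-step analysis for the probability that the loop ends within `n` iterations. -/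
theorem sum_whileExit_univ_succ (hc : MeasurableSet {s | c s}) (hb : Measurable body) {s : σ}
    (hs : c s) (n : ℕ) :
    ∑ k ∈ Finset.range (n + 1), whileExit c body k s Set.univ =
      ∫⁻ t, ∑ k ∈ Finset.range n, whileExit c body k t Set.univ ∂body s := by
  rw [Finset.sum_range_succ', whileExit_zero_of hs, lintegral_finsetSum _ fun k _ =>
    Measure.measurable_measure.1 (measurable_whileExit hc hb k) _ MeasurableSet.univ]
  simp only [Measure.coe_zero, Pi.zero_apply, add_zero]
  refine Finset.sum_congr rfl fun k _ => ?_
  rw [whileExit_succ_of hs,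
    Measure.bind_apply MeasurableSet.univ (measurable_whileExit hc hb k).aemeasurable]

theorem sum_whileExit_univ_of_not {s : σ} (hs : ¬ c s) (n : ℕ) :
    ∑ k ∈ Finset.range (n + 1), whileExit c body k s Set.univ = 1 := by
  rw [Finset.sum_range_succ', whileExit_zero_of_not hs]
  simp [whileExit_succ_of_not hs]

/-- A loop whose body fails to end the loop with probability at most `κ < 1`, whatever the current
state, terminates almost surely. -/
theorem isProbabilityMeasure_whileLoop (hc : MeasurableSet {s | c s}) (hb : Measurable body)
    (hprob : ∀ s, IsProbabilityMeasure (body s)) {κ : ℝ≥0∞} (hκ : κ < 1)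
    (hexit : ∀ s, c s → body s {t | c t} ≤ κ) (s : σ) :
    IsProbabilityMeasure (whileLoop c body s) := by
  have hle : ∀ n s, ∑ k ∈ Finset.range n, whileExit c body k s Set.univ ≤ 1 := by
    intro n
    induction n with
    | zero => simp
    | succ n ih =>
      intro s
      by_cases h : c s
      · rw [sum_whileExit_univ_succ hc hb h]
        exact (lintegral_mono fun t => ih t).trans (by simp)
      · rw [sum_whileExit_univ_of_not h]
  -- The loop survives `n` iterations with probability at most `κ ^ n`. The indicator makes the
  -- induction close: its integral over one step is at most `κ`.
  have hge : ∀ n s, 1 ≤ ∑ k ∈ Finset.range (n + 1), whileExit c body k s Set.univ +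
      κ ^ n * {t | c t}.indicator 1 s := by
    intro n
    induction n with
    | zero =>
      intro s
      by_cases h : c s
      · simp [h]
      · rw [sum_whileExit_univ_of_not h]; simp
    | succ n ih =>
      intro s
      by_cases h : c s
      · rw [sum_whileExit_univ_succ hc hb h]
        have hm : Measurable fun t => ∑ k ∈ Finset.range (n + 1), whileExit c body k t Set.univ :=
          Finset.measurable_fun_sum _ fun k _ =>
            Measure.measurable_measure.1 (measurable_whileExit hc hb k) _ MeasurableSet.univ
        calc (1 : ℝ≥0∞) = ∫⁻ _, 1 ∂body s := by simp
          _ ≤ _ := lintegral_mono fun t => ih t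
          _ = ∫⁻ t, ∑ k ∈ Finset.range (n + 1), whileExit c body k t Set.univ ∂body s +
              κ ^ n * body s {t | c t} := by
            rw [lintegral_add_left hm, lintegral_const_mul _ (measurable_one.indicator hc),
              lintegral_indicator_one hc]
          _ ≤ _ := by
            rw [Set.indicator_of_mem (show s ∈ {t | c t} from h), Pi.one_apply, mul_one, pow_succ]
            gcongr
            exact hexit s h
      · rw [sum_whileExit_univ_of_not h]; simp
  refine ⟨le_antisymm ?_ ?_⟩
  · rw [whileLoop, Measure.sum_apply _ MeasurableSet.univ]
    exact ENNReal.tsum_le_of_sum_range_le fun n => hle n s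
  · refine ge_of_tendsto' (x := Filter.atTop) (f := fun n => whileLoop c body s Set.univ + κ ^ n)
      ?_ fun n => (hge n s).trans ?_
    · simpa using tendsto_const_nhds.add (ENNReal.tendsto_pow_atTop_nhds_zero_of_lt_one hκ)
    · rw [whileLoop, Measure.sum_apply _ MeasurableSet.univ]
      refine add_le_add (ENNReal.sum_le_tsum _) ?_
      by_cases h : c s <;> simp [h]

end WhileLoop

/-! ### Gaussian noise -/

section Gaussian

theorem RenyiBound.prod {X Y : Type*} [MeasurableSpace X] [MeasurableSpace Y] {α a b : ℝ}
    {P P' : Measure X} {Q Q' : Measure Y} [SFinite Q] [SFinite Q'] (hα : 1 < α)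
    (h : RenyiBound α a P P') (h' : RenyiBound α b Q Q') :
    RenyiBound α (a + b) (P.prod Q) (P'.prod Q') := by
  rw [Measure.prod, Measure.prod]
  exact h.bind hα (measurable_map_param Q measurable_id) (measurable_map_param Q' measurable_id)
    fun x => h'.map measurable_prodMk_left

/-- Independent coordinates are a special case of composition, with kernels that ignore the past. -/
theorem RenyiBound.pi {X : Type*} [MeasurableSpace X] {α : ℝ} (hα : 1 < α) {n : ℕ}
    {a : Fin n → ℝ} {P Q : Fin n → Measure X} [∀ i, IsProbabilityMeasure (P i)]
    [∀ i, IsProbabilityMeasure (Q i)] (h : ∀ i, RenyiBound α (a i) (P i) (Q i)) :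
    RenyiBound α (∑ i, a i) (Measure.pi P) (Measure.pi Q) := by
  induction n with
  | zero =>
    rw [Subsingleton.elim P Q]
    exact RenyiBound.refl hα (by simp) _
  | succ n ih =>
    have key := ((h 0).prod hα (ih fun i => h i.succ)).map
      (MeasurableEquiv.piFinSuccAbove (fun _ : Fin (n + 1) => X) 0).symm.measurable
    have e (R : Fin (n + 1) → Measure X) [∀ i, IsProbabilityMeasure (R i)] :=
      ((measurePreserving_piFinSuccAbove R 0).symm _).map_eq
    rw [Fin.sum_univ_succ, ← e P, ← e Q]
    exact key

theorem gaussianReal_eq_withDensity (a : ℝ) :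
    gaussianReal a 1 =
      (gaussianReal 0 1).withDensity fun x => ENNReal.ofReal (Real.exp (a * x - a ^ 2 / 2)) := by
  rw [gaussianReal_of_var_ne_zero _ one_ne_zero, gaussianReal_of_var_ne_zero _ one_ne_zero,
    ← withDensity_mul _ (measurable_gaussianPDF _ _) (by fun_prop)]
  congr 1 with x
  rw [Pi.mul_apply, gaussianPDF, gaussianPDF, ← ENNReal.ofReal_mul (gaussianPDFReal_nonneg _ _ _),
    gaussianPDFReal, gaussianPDFReal, mul_assoc _ (Real.exp _), ← Real.exp_add]
  congr 3
  simp only [NNReal.coe_one]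
  ring

/-- The `α`-th moment of the likelihood ratio is the Gaussian moment generating function at `α * a`;
the exponent is `α² a² / 2 - α a² / 2`. -/
theorem renyiBound_gaussianReal {α : ℝ} (hα : 1 < α) (a : ℝ) :
    RenyiBound α (a ^ 2 / 2) (gaussianReal a 1) (gaussianReal 0 1) := by
  rw [gaussianReal_eq_withDensity a]
  refine RenyiBound.withDensity hα (by fun_prop) (le_of_eq ?_)
  have e (x : ℝ) : ENNReal.ofReal (Real.exp (a * x - a ^ 2 / 2)) ^ α =
      ENNReal.ofReal (Real.exp (-(α * a ^ 2 / 2))) * ENNReal.ofReal (Real.exp (α * a * x)) := by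
    rw [ENNReal.ofReal_rpow_of_pos (Real.exp_pos _), ← Real.exp_mul,
      ← ENNReal.ofReal_mul (Real.exp_nonneg _), ← Real.exp_add]
    ring_nf
  simp_rw [e]
  rw [lintegral_const_mul _ (by fun_prop), ← ofReal_integral_eq_lintegral_ofReal
    (integrable_exp_mul_gaussianReal _) (ae_of_all _ fun _ => Real.exp_nonneg _),
    ← ENNReal.ofReal_mul (Real.exp_nonneg _)]
  have := congrFun (mgf_id_gaussianReal (μ := 0) (v := 1)) (α * a)
  simp only [mgf, id] at this
  rw [this, ← Real.exp_add]
  congr 2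
  simp only [NNReal.coe_one]
  ring

variable {p : ℕ}

-- Realising all Gaussians from one fixed noise gives joint measurability in mean and variance. No
-- sign condition on `v` is needed: for `v < 0` both sides degenerate to the point mass at `μ`.
open scoped MatrixOrder in
theorem gaussian_eq_map (μ : E p) (v : ℝ) :
    gaussian μ v = (stdGaussian (E p)).map fun x => μ + √v • x := by
  rw [gaussian]
  rcases le_or_gt 0 v with hv | hv
  · rw [multivariateGaussian]
    have : CFC.sqrt (v • (1 : Matrix (Fin p) (Fin p) ℝ)) =
        √v • (1 : Matrix (Fin p) (Fin p) ℝ) := by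
      refine CFC.sqrt_unique ?_ ?_
      · rw [smul_mul_smul_comm, Real.mul_self_sqrt hv, one_mul]
      · exact (Matrix.PosSemidef.one.smul (Real.sqrt_nonneg v)).nonneg
    rw [this]
    simp
  -- The empty covariance matrix is positive semidefinite even for negative `v`, so dimension zero
  -- is separate.
  · rcases p with _ | p
    · have : (fun x : E 0 => μ + √v • x) = id := by ext x i; exact i.elim0
      rw [this, Measure.map_id, multivariateGaussian]
      convert Measure.map_id using 2
      ext x i; exact i.elim0
    · rw [multivariateGaussian_of_not_posSemidef, Real.sqrt_eq_zero_of_nonpos hv.le]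
      · simp
      · intro h
        have := h.diag_nonneg (i := 0)
        simp at this
        linarith

instance isProbabilityMeasure_gaussian (μ : E p) (v : ℝ) : IsProbabilityMeasure (gaussian μ v) := by
  rw [gaussian]; infer_instance

theorem measurable_gaussian : Measurable fun x : E p × ℝ => gaussian x.1 x.2 := by
  simp_rw [gaussian_eq_map]
  refine measurable_map_param _ ?_
  simp only [Function.uncurry_def]
  fun_prop

/-- Rescaling by `√v` reduces to unit noise with mean shift `a`; the coordinates tensorise, and the
affine map back is post-processing. -/
theorem renyiBound_gaussian {α : ℝ} (hα : 1 < α) (μ μ' : E p) {v : ℝ} (hv : 0 < v) :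
    RenyiBound α (‖μ - μ'‖ ^ 2 / (2 * v)) (gaussian μ v) (gaussian μ' v) := by
  have hsv : 0 < √v := Real.sqrt_pos.2 hv
  set a : E p := (√v)⁻¹ • (μ - μ') with ha
  have h1 := (RenyiBound.pi hα fun i => renyiBound_gaussianReal hα (a i)).map
    (MeasurableEquiv.toLp 2 (Fin p → ℝ)).measurable
  have hsum : ∑ i, a i ^ 2 / 2 = ‖μ - μ'‖ ^ 2 / (2 * v) := by
    rw [← Finset.sum_div, ← EuclideanSpace.real_norm_sq_eq, ha, norm_smul, mul_pow, norm_inv,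
      inv_pow, Real.norm_of_nonneg hsv.le, Real.sq_sqrt hv.le]
    field_simp
  have h2 := h1.map (g := fun x : E p => μ' + √v • x) (by fun_prop)
  rw [hsum] at h2
  have e1 : Measure.pi (fun i => gaussianReal (a i) 1) =
      (Measure.pi fun _ : Fin p => gaussianReal 0 1).map fun x i => x i + a i := by
    rw [Measure.pi_map_pi (f := fun i x => x + a i) (fun i => by fun_prop)]
    congr 1 with i : 1
    rw [gaussianReal_map_add_const, zero_add]
  have e0 : (Measure.pi fun _ : Fin p => gaussianReal 0 1).map (MeasurableEquiv.toLp 2 (Fin p → ℝ)) =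
      stdGaussian (E p) := map_pi_eq_stdGaussian
  rw [e1, Measure.map_map (by fun_prop) (by fun_prop), Measure.map_map (by fun_prop) (by fun_prop),
    e0] at h2
  rw [gaussian_eq_map, gaussian_eq_map, ← e0, Measure.map_map (by fun_prop) (by fun_prop)]
  rw [← e0] at h2
  convert h2 using 2
  · ext x i
    simp [ha]
    field_simp
    ring

end Gaussian

/-! ### Laplace noise and NoisyMax -/

section NoisyMax

theorem measurable_laplace_density (b : ℝ) :
    Measurable fun x : ℝ => ENNReal.ofReal (Real.exp (-|x| / b) / (2 * b)) := by
  fun_prop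

theorem isProbabilityMeasure_laplace {b : ℝ} (hb : 0 < b) : IsProbabilityMeasure (laplace b) := by
  have hneg : -b⁻¹ < 0 := by simpa using hb
  have hpos : IntegrableOn (fun x : ℝ => Real.exp (-|x| / b)) (Set.Ioi 0) := by
    refine (integrableOn_exp_mul_Ioi hneg 0).congr_fun (fun x hx => ?_) measurableSet_Ioi
    simp only [abs_of_pos (Set.mem_Ioi.1 hx)]
    congr 1; field_simp
  have hint : Integrable fun x : ℝ => Real.exp (-|x| / b) := by
    rw [← integrableOn_univ, ← Set.Iic_union_Ioi (a := (0 : ℝ))]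
    refine IntegrableOn.union ?_ hpos
    have := hpos.comp_neg
    simpa [integrableOn_Iic_iff_integrableOn_Iio] using this
  have hval : ∫ x : ℝ, Real.exp (-|x| / b) = 2 * b := by
    rw [integral_comp_abs (f := fun x => Real.exp (-x / b))]
    have := integral_exp_mul_Ioi hneg 0
    rw [setIntegral_congr_fun measurableSet_Ioi
      (g := fun x => Real.exp (-b⁻¹ * x)) (fun x _ => by
        show Real.exp _ = Real.exp _
        congr 1; field_simp), this]
    simp
  refine ⟨?_⟩
  rw [laplace, withDensity_apply _ MeasurableSet.univ, Measure.restrict_univ,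
    ← ofReal_integral_eq_lintegral_ofReal (hint.div_const _) (ae_of_all _ fun x => by positivity),
    integral_div, hval, div_self (by positivity), ENNReal.ofReal_one]

theorem isOpenPosMeasure_laplace {b : ℝ} (hb : 0 < b) : (laplace b).IsOpenPosMeasure := by
  refine Measure.AbsolutelyContinuous.isOpenPosMeasure (μ := (volume : Measure ℝ)) ?_
  refine withDensity_absolutelyContinuous' (measurable_laplace_density b).aemeasurable ?_
  refine ae_of_all _ fun x => ?_
  simp only [ne_eq, ENNReal.ofReal_eq_zero, not_le]
  positivity

/-- Since `|x + Δ| ≤ |x| + Δ`, translation by `Δ` lowers the density by at most the factor `exp (-Δ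
/ b)`. -/
theorem laplace_le_of_shift {b Δ : ℝ} (hb : 0 < b) (hΔ : 0 ≤ Δ) {s t : Set ℝ}
    (hs : MeasurableSet s) (ht : MeasurableSet t) (hst : ∀ x ∈ s, x + Δ ∈ t) :
    laplace b s ≤ ENNReal.ofReal (Real.exp (Δ / b)) * laplace b t := by
  rw [laplace, withDensity_apply _ hs, withDensity_apply _ ht, ← lintegral_indicator hs,
    ← lintegral_indicator ht, ← lintegral_const_mul _ ((measurable_laplace_density b).indicator ht),
    ← lintegral_add_right_eq_self (μ := volume) (fun x => ENNReal.ofReal (Real.exp (Δ / b)) * _) Δ]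
  refine lintegral_mono fun x => ?_
  by_cases hx : x ∈ s
  · rw [Set.indicator_of_mem hx, Set.indicator_of_mem (hst x hx),
      ← ENNReal.ofReal_mul (Real.exp_nonneg _), ← mul_div_assoc, ← Real.exp_add, ← add_div]
    refine ENNReal.ofReal_le_ofReal ?_
    gcongr
    have := abs_add_le x Δ
    rw [abs_of_nonneg hΔ] at this
    linarith
  · rw [Set.indicator_of_notMem hx]; exact zero_le

variable {m : ℕ}

theorem argmax_eq_iff (v : Fin (m + 1) → ℝ) (j : Fin (m + 1)) :
    argmax v = j ↔ (∀ k, v k ≤ v j) ∧ ∀ k < j, v k < v j := by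
  rw [argmax, Finset.min'_eq_iff]
  simp only [Finset.mem_filter, Finset.mem_univ, true_and]
  refine and_congr_right fun h => ⟨fun h' k hk => ?_, fun h' k hk => ?_⟩
  · by_contra hlt
    exact absurd (h' k fun l => (h l).trans (not_lt.1 hlt)) (not_le.2 hk)
  · by_contra hlt
    exact absurd (h' k (not_le.1 hlt)) (not_lt.2 (hk j))

theorem measurable_argmax : Measurable (argmax : (Fin (m + 1) → ℝ) → Fin (m + 1)) := by
  refine measurable_to_countable' fun j => ?_
  have : argmax ⁻¹' {j} = (⋂ k, {v : Fin (m + 1) → ℝ | v k ≤ v j}) ∩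
      ⋂ k, ⋂ _ : k < j, {v : Fin (m + 1) → ℝ | v k < v j} := by
    ext v; simp [argmax_eq_iff]
  rw [this]
  exact (MeasurableSet.iInter fun k => measurableSet_le (by fun_prop) (by fun_prop)).inter
    (MeasurableSet.iInter fun k => MeasurableSet.iInter fun _ =>
      measurableSet_lt (by fun_prop) (by fun_prop))

theorem measurable_argmax_add (v : Fin (m + 1) → ℝ) : Measurable fun z => argmax (v + z) :=
  measurable_argmax.comp (measurable_const_add v)

theorem isProbabilityMeasure_noisyMax (v : Fin (m + 1) → ℝ) {Δ ε : ℝ} (hΔ : 0 < Δ) (hε : 0 < ε) :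
    IsProbabilityMeasure (noisyMax v Δ ε) := by
  have := isProbabilityMeasure_laplace (div_pos hΔ hε)
  exact Measure.isProbabilityMeasure_map (measurable_argmax_add v).aemeasurable

theorem measurable_noisyMax {Δ ε : ℝ} (hΔ : 0 < Δ) (hε : 0 < ε) :
    Measurable fun v : Fin (m + 1) → ℝ => noisyMax v Δ ε := by
  have := isProbabilityMeasure_laplace (div_pos hΔ hε)
  exact measurable_map_param _ (measurable_argmax.comp (measurable_fst.add measurable_snd))

/-- NoisyMax is `ε`-indistinguishable on score vectors whose pairwise differences deviate by at
most the sensitivity. -/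
theorem noisyMax_singleton_le {v v' : Fin (m + 1) → ℝ} {Δ ε : ℝ} (hΔ : 0 < Δ) (hε : 0 < ε)
    (h : ∀ j k, v j - v k ≤ v' j - v' k + Δ) (j : Fin (m + 1)) :
    noisyMax v Δ ε {j} ≤ ENNReal.ofReal (Real.exp ε) * noisyMax v' Δ ε {j} := by
  have hb : 0 < Δ / ε := div_pos hΔ hε
  have := isProbabilityMeasure_laplace hb
  -- The noise of all indices other than `j` is frozen. Raising the noise of `j` alone by `Δ` turns
  -- a win under `v` into a win under `v'`; moving only the winner is why the cost is `ε` and not `2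
  -- * ε`.
  let e := MeasurableEquiv.piFinSuccAbove (fun _ : Fin (m + 1) => ℝ) j
  let S (u : Fin (m + 1) → ℝ) : Set (ℝ × (Fin m → ℝ)) :=
    e.symm ⁻¹' ((fun z => argmax (u + z)) ⁻¹' {j})
  have hS (u) : MeasurableSet (S u) :=
    e.symm.measurable (measurable_argmax_add u (measurableSet_singleton j))
  have hval (u) : noisyMax u Δ ε {j} =
      ∫⁻ y, laplace (Δ / ε) ((fun x => (x, y)) ⁻¹' S u) ∂Measure.pi fun _ : Fin m =>
        laplace (Δ / ε) := by
    rw [noisyMax, Measure.map_apply (measurable_argmax_add u) (measurableSet_singleton j),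
      ← ((measurePreserving_piFinSuccAbove (fun _ : Fin (m + 1) => laplace (Δ / ε)) j).symm
        _).map_eq, Measure.map_apply e.symm.measurable
        (measurable_argmax_add u (measurableSet_singleton j)), Measure.prod_apply_symm (hS u)]
  have hmeas : Measurable fun y => laplace (Δ / ε) ((fun x => (x, y)) ⁻¹' S v') :=
    measurable_measure_prodMk_right (hS v')
  rw [hval, hval, ← lintegral_const_mul _ hmeas]
  refine lintegral_mono fun y => ?_
  nth_rewrite 2 [show ε = Δ / (Δ / ε) by field_simp]
  refine laplace_le_of_shift hb hΔ.le (measurable_prodMk_right (hS v))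
    (measurable_prodMk_right (hS v')) fun x hx => ?_
  have e1 (x : ℝ) : e.symm (x, y) j = x := by simp [e]
  have e2 (x : ℝ) (k : Fin m) : e.symm (x, y) (j.succAbove k) = y k := by simp [e]
  simp only [S, Set.mem_preimage, Set.mem_singleton_iff, argmax_eq_iff, Pi.add_apply] at hx ⊢
  have key (k : Fin (m + 1)) (hk : k ≠ j) :
      e.symm (x + Δ, y) k = e.symm (x, y) k := by
    obtain ⟨l, rfl⟩ := Fin.exists_succAbove_eq hk
    rw [e2, e2]
  rw [e1] at hx ⊢
  refine ⟨fun k => ?_, fun k hk => ?_⟩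
  · rcases eq_or_ne k j with rfl | hk
    · rw [e1]
    · rw [key k hk]
      linarith [hx.1 k, h j k]
  · rw [key k hk.ne]
    linarith [hx.2 k hk, h j k]

/-- If the scores are confined to an interval of length `B`, NoisyMax returns the index `0` with
probability bounded away from `1`. -/
theorem exists_noisyMax_zero_le (hm : 1 ≤ m) {Δ ε : ℝ} (hΔ : 0 < Δ) (hε : 0 < ε) (B : ℝ) :
    ∃ κ : ℝ≥0∞, κ < 1 ∧ ∀ v : Fin (m + 1) → ℝ, (∀ j k, v j - v k ≤ B) →
      noisyMax v Δ ε {0} ≤ κ := by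
  have hb : 0 < Δ / ε := div_pos hΔ hε
  have := isProbabilityMeasure_laplace hb
  have := isOpenPosMeasure_laplace hb
  set μ : Measure (Fin (m + 1) → ℝ) := Measure.pi fun _ => laplace (Δ / ε)
  let i : Fin (m + 1) := ⟨1, by omega⟩
  have hi : i ≠ 0 := by simp [i, Fin.ext_iff]
  -- On `U` index `1` beats index `0` for all admissible scores. `U` does not depend on the scores,
  -- and being open and nonempty it has positive mass.
  set U : Set (Fin (m + 1) → ℝ) := {z | z 0 + B < z i} with hU
  have hopen : IsOpen U := isOpen_lt (by fun_prop) (by fun_prop)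
  have hne : U.Nonempty := ⟨fun k => if k = 0 then 0 else B + 1, by simp [hU, hi]⟩
  refine ⟨μ Uᶜ, ?_, fun v hv => ?_⟩
  · rw [prob_compl_eq_one_sub hopen.measurableSet]
    exact ENNReal.sub_lt_self ENNReal.one_ne_top one_ne_zero (hopen.measure_pos μ hne).ne'
  · rw [noisyMax, Measure.map_apply (measurable_argmax_add v) (measurableSet_singleton _)]
    refine measure_mono fun z hz hzU => ?_
    have h1 := ((argmax_eq_iff _ _).1 hz).1 i
    simp only [Pi.add_apply] at h1
    simp only [hU, Set.mem_ofPred_eq] at hzU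
    linarith [hv 0 i]

end NoisyMax

/-! ### From pure indistinguishability to Rényi bounds -/

section Pure

/-- Hoeffding's lemma, applied to the log-likelihood ratio `Z` twice, bounds first the
Kullback-Leibler divergence and then all Rényi divergences. -/
theorem lintegral_exp_rpow_le {Ω : Type*} [MeasurableSpace Ω] {P Q : Measure Ω}
    [IsProbabilityMeasure P] [IsProbabilityMeasure Q] {Z : Ω → ℝ} {ε α : ℝ} (hα : 1 < α)
    (hZ : Measurable Z) (hb : ∀ ω, |Z ω| ≤ ε)
    (hPQ : P = Q.withDensity fun ω => ENNReal.ofReal (Real.exp (Z ω))) :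
    ∫⁻ ω, ENNReal.ofReal (Real.exp (Z ω)) ^ α ∂Q ≤
      ENNReal.ofReal (Real.exp (α * (α - 1) * (ε ^ 2 / 2))) := by
  have hsg := hasSubgaussianMGF_of_mem_Icc (μ := P) (a := -ε) (b := ε) hZ.aemeasurable
    (ae_of_all _ fun ω => abs_le.1 (hb ω))
  set k := ∫ ω, Z ω ∂P
  have hpar : ((((‖ε - -ε‖₊ / 2) ^ 2 : NNReal)) : ℝ) = ε ^ 2 := by
    push_cast
    rw [Real.norm_eq_abs, div_pow, sq_abs]
    ring
  have hmgf (t : ℝ) : ∫⁻ ω, ENNReal.ofReal (Real.exp (t * Z ω)) ∂P ≤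
      ENNReal.ofReal (Real.exp (t * k + ε ^ 2 * t ^ 2 / 2)) := by
    have h1 := hsg.mgf_le t
    rw [hpar, mgf] at h1
    have h2 : ∀ ω, ENNReal.ofReal (Real.exp (t * Z ω)) =
        ENNReal.ofReal (Real.exp (t * k)) * ENNReal.ofReal (Real.exp (t * (Z ω - k))) :=
      fun ω => by
        rw [← ENNReal.ofReal_mul (Real.exp_nonneg _), ← Real.exp_add]; ring_nf
    simp_rw [h2]
    rw [lintegral_const_mul _ (by fun_prop), ← ofReal_integral_eq_lintegral_ofReal
      (hsg.integrable_exp_mul t) (ae_of_all _ fun _ => Real.exp_nonneg _), Real.exp_add,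
      ENNReal.ofReal_mul (Real.exp_nonneg _)]
    gcongr
  have hdens (f : Ω → ℝ≥0∞) (hf : Measurable f) :
      ∫⁻ ω, f ω ∂P = ∫⁻ ω, ENNReal.ofReal (Real.exp (Z ω)) * f ω ∂Q := by
    rw [hPQ, lintegral_withDensity_eq_lintegral_mul _ (by fun_prop) hf]; rfl
  -- At `t = -1` the moment of `Z` under `P` is the total mass of `Q`, which is `1`.
  have hKL : k ≤ ε ^ 2 / 2 := by
    have h1 := hmgf (-1)
    rw [hdens _ (by fun_prop)] at h1
    simp_rw [← ENNReal.ofReal_mul (Real.exp_nonneg _), ← Real.exp_add] at h1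
    simp only [neg_mul, one_mul, add_neg_cancel, Real.exp_zero, ENNReal.ofReal_one,
      lintegral_const, measure_univ, mul_one, ENNReal.one_le_ofReal, Real.one_le_exp_iff] at h1
    linarith
  have h1 := hmgf (α - 1)
  rw [hdens _ (by fun_prop)] at h1
  refine le_trans (le_of_eq (lintegral_congr fun ω => ?_))
    (h1.trans (ENNReal.ofReal_le_ofReal (Real.exp_le_exp.2 ?_)))
  · rw [ENNReal.ofReal_rpow_of_pos (Real.exp_pos _), ← Real.exp_mul,
      ← ENNReal.ofReal_mul (Real.exp_nonneg _), ← Real.exp_add]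
    ring_nf
  · nlinarith [mul_le_mul_of_nonneg_left hKL (by linarith : 0 ≤ α - 1)]

theorem renyiBound_of_singleton_le {Ω : Type*} [MeasurableSpace Ω] [Countable Ω]
    [MeasurableSingletonClass Ω] {P Q : Measure Ω} [IsProbabilityMeasure P]
    [IsProbabilityMeasure Q] {ε α : ℝ} (hα : 1 < α) (hε : 0 ≤ ε)
    (h1 : ∀ ω, P {ω} ≤ ENNReal.ofReal (Real.exp ε) * Q {ω})
    (h2 : ∀ ω, Q {ω} ≤ ENNReal.ofReal (Real.exp ε) * P {ω}) :
    RenyiBound α (ε ^ 2 / 2) P Q := by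
  have h1' (ω) : P.real {ω} ≤ Real.exp ε * Q.real {ω} := by
    have := ENNReal.toReal_mono (by finiteness) (h1 ω)
    rwa [ENNReal.toReal_mul, ENNReal.toReal_ofReal (Real.exp_nonneg _)] at this
  have h2' (ω) : Q.real {ω} ≤ Real.exp ε * P.real {ω} := by
    have := ENNReal.toReal_mono (by finiteness) (h2 ω)
    rwa [ENNReal.toReal_mul, ENNReal.toReal_ofReal (Real.exp_nonneg _)] at this
  -- Where `Q` has no atom, neither has `P`; the default value `log 0 = 0` is then harmless.
  let Z : Ω → ℝ := fun ω => Real.log (P.real {ω} / Q.real {ω})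
  have hZ : Measurable Z := measurable_of_countable Z
  have hpos (ω) (hQ : Q.real {ω} ≠ 0) : 0 < Q.real {ω} ∧ 0 < P.real {ω} := by
    have hq : 0 < Q.real {ω} := lt_of_le_of_ne measureReal_nonneg hQ.symm
    refine ⟨hq, ?_⟩
    by_contra hP
    have : P.real {ω} = 0 := le_antisymm (not_lt.1 hP) measureReal_nonneg
    have h3 := h2' ω
    rw [this, mul_zero] at h3
    linarith
  have hb (ω) : |Z ω| ≤ ε := by
    by_cases hQ : Q.real {ω} = 0
    · simp [Z, hQ, hε]
    obtain ⟨hq, hp⟩ := hpos ω hQ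
    rw [abs_le]
    constructor
    · rw [Real.le_log_iff_exp_le (by positivity), le_div_iff₀ hq, Real.exp_neg,
        inv_mul_le_iff₀ (Real.exp_pos _)]
      exact h2' ω
    · rw [Real.log_le_iff_le_exp (by positivity), div_le_iff₀ hq]
      exact h1' ω
  have hPQ : P = Q.withDensity fun ω => ENNReal.ofReal (Real.exp (Z ω)) := by
    refine Measure.ext_of_singleton fun ω => ?_
    rw [withDensity_apply _ (measurableSet_singleton ω), lintegral_singleton,
      ← ofReal_measureReal, ← ofReal_measureReal (μ := Q), ← ENNReal.ofReal_mul (Real.exp_nonneg _)]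
    congr 1
    by_cases hQ : Q.real {ω} = 0
    · have h3 := h1' ω
      rw [hQ, mul_zero] at h3 ⊢
      exact le_antisymm h3 measureReal_nonneg
    obtain ⟨hq, hp⟩ := hpos ω hQ
    rw [Real.exp_log (by positivity), div_mul_cancel₀ _ hQ]
  have h := lintegral_exp_rpow_le hα hZ hb hPQ
  rw [hPQ]
  exact RenyiBound.withDensity hα (by fun_prop) h

theorem renyiBound_noisyMax {m : ℕ} {v v' : Fin (m + 1) → ℝ} {Δ ε α : ℝ} (hα : 1 < α) (hΔ : 0 < Δ)
    (hε : 0 < ε) (h : ∀ j k, |(v j - v k) - (v' j - v' k)| ≤ Δ) :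
    RenyiBound α (ε ^ 2 / 2) (noisyMax v Δ ε) (noisyMax v' Δ ε) := by
  have := isProbabilityMeasure_noisyMax v hΔ hε
  have := isProbabilityMeasure_noisyMax v' hΔ hε
  exact renyiBound_of_singleton_le hα hε.le
    (noisyMax_singleton_le hΔ hε fun j k => by linarith [(abs_le.1 (h j k)).2])
    (noisyMax_singleton_le hΔ hε fun j k => by linarith [(abs_le.1 (h j k)).1])

end Pure

/-! ### Sensitivity and measurability of the building blocks -/

instance (m : ℕ) : DiscreteMeasurableSpace (History m) := ⟨fun _ => trivial⟩

variable {𝒟 : Type*} {p m : ℕ}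

/-- The assumptions on the inputs of the algorithm. -/
structure Admissible (A : Params 𝒟 p m) : Prop where
  one_le : 1 ≤ m
  measurable_loss : ∀ d, Measurable (A.loss d)
  loss_nonneg : ∀ d w, 0 ≤ A.loss d w
  measurable_grad : ∀ d, Measurable (A.grad d)
  ρnmax_pos : 0 < A.ρnmax
  γ_pos : 0 < A.γ
  Cobj_pos : 0 < A.Cobj
  Cgrad_pos : 0 < A.Cgrad

/-- The privacy-relevant closeness of two databases: pairwise differences of clipped objectives
and clipped gradients deviate by at most the respective clipping thresholds. -/
structure SensitivityBound (A : Params 𝒟 p m) (D D' : Multiset 𝒟) : Prop where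
  obj : ∀ w w', |(clippedObj A D w - clippedObj A D w') -
    (clippedObj A D' w - clippedObj A D' w')| ≤ A.Cobj
  grad : ∀ w, ‖clippedGrad A D w - clippedGrad A D' w‖ ≤ A.Cgrad

section Sensitivity

variable {A : Params 𝒟 p m}

theorem clippedObj_cons (A : Params 𝒟 p m) (d : 𝒟) (D : Multiset 𝒟) (w : E p) :
    clippedObj A (d ::ₘ D) w = min (A.loss d w) A.Cobj + clippedObj A D w := by
  simp [clippedObj]

theorem clippedGrad_cons (A : Params 𝒟 p m) (d : 𝒟) (D : Multiset 𝒟) (w : E p) :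
    clippedGrad A (d ::ₘ D) w =
      (max 1 (‖A.grad d w‖ / A.Cgrad))⁻¹ • A.grad d w + clippedGrad A D w := by
  simp [clippedGrad]

theorem Admissible.measurable_clippedObj (hA : Admissible A) (D : Multiset 𝒟) :
    Measurable (clippedObj A D) := by
  induction D using Multiset.induction with
  | empty => exact measurable_const
  | cons d D ih =>
    simp_rw [funext (clippedObj_cons A d D)]
    exact ((hA.measurable_loss d).min measurable_const).add ih

theorem Admissible.measurable_clippedGrad (hA : Admissible A) (D : Multiset 𝒟) :
    Measurable (clippedGrad A D) := by
  induction D using Multiset.induction with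
  | empty => exact measurable_const
  | cons d D ih =>
    simp_rw [funext (clippedGrad_cons A d D)]
    have := hA.measurable_grad d
    exact (((measurable_const.max (this.norm.div_const _)).inv).smul this).add ih

theorem Admissible.clippedObj_mem_Icc (hA : Admissible A) (D : Multiset 𝒟) (w : E p) :
    clippedObj A D w ∈ Set.Icc 0 (Multiset.card D * A.Cobj) := by
  induction D using Multiset.induction with
  | empty => simp [clippedObj]
  | cons d D ih =>
    rw [clippedObj_cons, Multiset.card_cons]
    push_cast
    have h1 : 0 ≤ min (A.loss d w) A.Cobj := le_min (hA.loss_nonneg d w) hA.Cobj_pos.le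
    have h2 := min_le_right (A.loss d w) A.Cobj
    exact ⟨by linarith [ih.1], by linarith [ih.2]⟩

theorem norm_clip_le {F : Type*} [NormedAddCommGroup F] [NormedSpace ℝ F] {C : ℝ} (hC : 0 < C)
    (x : F) : ‖(max 1 (‖x‖ / C))⁻¹ • x‖ ≤ C := by
  have h1 : 0 < max 1 (‖x‖ / C) := lt_max_of_lt_left one_pos
  rw [norm_smul, norm_inv, Real.norm_of_nonneg h1.le, inv_mul_le_iff₀ h1, ← div_le_iff₀ hC]
  exact le_max_right _ _

/-- The added clipped losses lie in `[0, Cobj]`, so the difference of two of them is at most `Cobj`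
in absolute value. Nonnegativity of the loss avoids a factor of two. -/
theorem Admissible.sensitivityBound_cons (hA : Admissible A) (d : 𝒟) (D : Multiset 𝒟) :
    SensitivityBound A D (d ::ₘ D) where
  obj w w' := by
    have h (w) : 0 ≤ min (A.loss d w) A.Cobj := le_min (hA.loss_nonneg d w) hA.Cobj_pos.le
    have h' (w) := min_le_right (A.loss d w) A.Cobj
    rw [clippedObj_cons, clippedObj_cons, abs_le]
    constructor <;> linarith [h w, h w', h' w, h' w']
  grad w := by
    rw [clippedGrad_cons, sub_add_cancel_right, norm_neg]
    exact norm_clip_le hA.Cgrad_pos _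

theorem SensitivityBound.symm {D D' : Multiset 𝒟} (h : SensitivityBound A D D') :
    SensitivityBound A D' D where
  obj w w' := by rw [abs_sub_comm]; exact h.obj w w'
  grad w := by rw [norm_sub_rev]; exact h.grad w

/-- Comparing a database with itself lets the privacy induction yield termination too. -/
theorem Admissible.sensitivityBound_self (hA : Admissible A) (D : Multiset 𝒟) :
    SensitivityBound A D D where
  obj w w' := by simpa using hA.Cobj_pos.le
  grad w := by simpa using hA.Cgrad_pos.le

theorem Admissible.sensitivityBound (hA : Admissible A) {D D' : Multiset 𝒟} (h : Neighbor D D') :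
    SensitivityBound A D D' := by
  obtain ⟨d, rfl | rfl⟩ := h
  · exact hA.sensitivityBound_cons d D
  · exact (hA.sensitivityBound_cons d D').symm

theorem Admissible.sqrt_pos (hA : Admissible A) : 0 < √(2 * A.ρnmax) :=
  Real.sqrt_pos.2 (mul_pos two_pos hA.ρnmax_pos)

end Sensitivity

/-! ### Measurable dependence of the loop bodies on the state -/

section Measurability

instance isProbabilityMeasure_gradAvg (ρold ρH : ℝ) (g g' : E p) (C : ℝ) :
    IsProbabilityMeasure (gradAvg ρold ρH g g' C) :=
  Measure.isProbabilityMeasure_map (by fun_prop)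

theorem measurable_gradAvg (C : ℝ) :
    Measurable fun x : ℝ × ℝ × E p × E p => gradAvg x.1 x.2.1 x.2.2.1 x.2.2.2 C := by
  have h (x : ℝ × ℝ × E p × E p) : gradAvg x.1 x.2.1 x.2.2.1 x.2.2.2 C =
      (gaussian x.2.2.1 (C ^ 2 / (2 * (x.2.1 - x.1)))).bind fun g₂ =>
        Measure.dirac (x.2.1⁻¹ • (x.1 • x.2.2.2 + (x.2.1 - x.1) • g₂)) :=
    (Measure.bind_dirac_eq_map _ (by fun_prop)).symm
  simp_rw [h]
  refine measurable_bind_param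
    (measurable_gaussian.comp (f := fun x : ℝ × ℝ × E p × E p =>
      (x.2.2.1, C ^ 2 / (2 * (x.2.1 - x.1)))) (by fun_prop)) (fun _ => inferInstance) ?_
  exact Measure.measurable_dirac.comp (by fun_prop)

/-- The scores given to NoisyMax. -/
def scores (A : Params 𝒟 p m) (D : Multiset 𝒟) (s : InnerState p m) (j : Fin (m + 1)) : ℝ :=
  -clippedObj A D (s.1 - A.Φ s.2.1 j • s.2.2.2.1)

open scoped Classical in
/-- The continuation of the body of the inner loop once NoisyMax has selected an index. -/
def afterSelection (A : Params 𝒟 p m) : InnerState p m → Fin (m + 1) → Measure (InnerState p m)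
  | (w, h, g, g', ρng, ρ, _), i =>
    let ρ₁ := ρ - A.ρnmax
    if 0 < i then
      if 0 < ρ₁ then Measure.dirac (w - A.Φ h i • g', h ++ [i], g, g', ρng, ρ₁, i)
      else Measure.dirac (w, h, g, g', ρng, ρ₁, i)
    else
      let ρng₁ := (1 + A.γ) * ρng
      (gradAvg ρng ρng₁ g g' A.Cgrad).bind fun g'₁ =>
        Measure.dirac (w, h, g, g'₁, ρng₁, ρ₁ - (ρng₁ - ρng), i)

variable {A : Params 𝒟 p m}

theorem innerBody_eq (A : Params 𝒟 p m) (D : Multiset 𝒟) (s : InnerState p m) :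
    innerBody A D s =
      (noisyMax (scores A D s) A.Cobj (√(2 * A.ρnmax))).bind (afterSelection A s) := rfl

theorem measurable_stepSize (A : Params 𝒟 p m) :
    Measurable fun x : History m × Fin (m + 1) => A.Φ x.1 x.2 := Measurable.of_discrete

theorem measurable_append (m : ℕ) :
    Measurable fun x : History m × Fin (m + 1) => x.1 ++ [x.2] := Measurable.of_discrete

theorem Admissible.measurable_scores (hA : Admissible A) (D : Multiset 𝒟) :
    Measurable (scores A D) := by
  refine measurable_pi_iff.2 fun j => ((hA.measurable_clippedObj D).comp ?_).neg
  have : Measurable fun s : InnerState p m => A.Φ s.2.1 j :=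
    (measurable_stepSize A).comp (f := fun s : InnerState p m => (s.2.1, j)) (by fun_prop)
  fun_prop

theorem measurable_afterSelection (A : Params 𝒟 p m) :
    Measurable (Function.uncurry (afterSelection A)) := by
  classical
  have hΦ : Measurable fun x : InnerState p m × Fin (m + 1) => A.Φ x.1.2.1 x.2 :=
    (measurable_stepSize A).comp
      (f := fun x : InnerState p m × Fin (m + 1) => (x.1.2.1, x.2)) (by fun_prop)
  have happ : Measurable fun x : InnerState p m × Fin (m + 1) => x.1.2.1 ++ [x.2] :=
    (measurable_append m).comp
      (f := fun x : InnerState p m × Fin (m + 1) => (x.1.2.1, x.2)) (by fun_prop)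
  refine Measurable.ite (p := fun x : InnerState p m × Fin (m + 1) => 0 < x.2)
    (measurable_snd (MeasurableSet.of_discrete (s := {i | 0 < i}))) ?_ ?_
  · refine Measurable.ite
      (p := fun x : InnerState p m × Fin (m + 1) => 0 < x.1.2.2.2.2.2.1 - A.ρnmax)
      (measurableSet_lt (by fun_prop) (by fun_prop)) ?_ ?_
    · exact Measure.measurable_dirac.comp (f := fun x : InnerState p m × Fin (m + 1) =>
        ((x.1.1 - A.Φ x.1.2.1 x.2 • x.1.2.2.2.1, x.1.2.1 ++ [x.2], x.1.2.2.1, x.1.2.2.2.1,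
          x.1.2.2.2.2.1, x.1.2.2.2.2.2.1 - A.ρnmax, x.2) : InnerState p m)) (by fun_prop)
    · exact Measure.measurable_dirac.comp (f := fun x : InnerState p m × Fin (m + 1) =>
        ((x.1.1, x.1.2.1, x.1.2.2.1, x.1.2.2.2.1,
          x.1.2.2.2.2.1, x.1.2.2.2.2.2.1 - A.ρnmax, x.2) : InnerState p m)) (by fun_prop)
  · refine measurable_bind_param (κ := fun x : InnerState p m × Fin (m + 1) =>
      gradAvg x.1.2.2.2.2.1 ((1 + A.γ) * x.1.2.2.2.2.1) x.1.2.2.1 x.1.2.2.2.1 A.Cgrad)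
      (K := fun x g => Measure.dirac ((x.1.1, x.1.2.1, x.1.2.2.1, g, (1 + A.γ) * x.1.2.2.2.2.1,
        x.1.2.2.2.2.2.1 - A.ρnmax - ((1 + A.γ) * x.1.2.2.2.2.1 - x.1.2.2.2.2.1), x.2) :
          InnerState p m))
      ((measurable_gradAvg A.Cgrad).comp (f := fun x : InnerState p m × Fin (m + 1) =>
        (x.1.2.2.2.2.1, (1 + A.γ) * x.1.2.2.2.2.1, x.1.2.2.1, x.1.2.2.2.1)) (by fun_prop))
      (fun _ => inferInstance) (Measure.measurable_dirac.comp ?_)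
    fun_prop

theorem measurable_afterSelection_right (A : Params 𝒟 p m) (s : InnerState p m) :
    Measurable (afterSelection A s) := (measurable_afterSelection A).comp measurable_prodMk_left

theorem Admissible.isProbabilityMeasure_noisyMax (hA : Admissible A) (v : Fin (m + 1) → ℝ) :
    IsProbabilityMeasure (noisyMax v A.Cobj (√(2 * A.ρnmax))) :=
  DPAGD.isProbabilityMeasure_noisyMax v hA.Cobj_pos hA.sqrt_pos

theorem Admissible.measurable_innerBody (hA : Admissible A) (D : Multiset 𝒟) :
    Measurable (innerBody A D) :=
  measurable_bind_param ((measurable_noisyMax hA.Cobj_pos hA.sqrt_pos).comp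
    (hA.measurable_scores D)) (fun _ => hA.isProbabilityMeasure_noisyMax _)
    (measurable_afterSelection A)

theorem measurableSet_innerCond (p m : ℕ) :
    MeasurableSet {s : InnerState p m | s.2.2.2.2.2.2 = 0} :=
  (show Measurable fun s : InnerState p m => s.2.2.2.2.2.2 by fun_prop)
    (measurableSet_singleton 0)

theorem Admissible.measurable_innerLoop (hA : Admissible A) (D : Multiset 𝒟) :
    Measurable (innerLoop A D) :=
  measurable_whileLoop (measurableSet_innerCond p m) (hA.measurable_innerBody D)

/-- The outer state in which the outer loop continues when the inner loop is left. -/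
def toOuter (s : InnerState p m) : OuterState p m := (s.1, s.2.1, s.2.2.2.2.1, s.2.2.2.2.2.1)

theorem measurable_toOuter : Measurable (toOuter : InnerState p m → OuterState p m) := by
  unfold toOuter; fun_prop

/-- The state in which the inner loop is entered after a gradient measurement `g'`. -/
def enterInner (A : Params 𝒟 p m) (D : Multiset 𝒟) (s : OuterState p m) (g' : E p) :
    InnerState p m :=
  (s.1, s.2.1, clippedGrad A D s.1, ‖g'‖⁻¹ • g', s.2.2.1, s.2.2.2 - s.2.2.1, 0)

theorem Admissible.measurable_enterInner (hA : Admissible A) (D : Multiset 𝒟) :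
    Measurable (Function.uncurry (enterInner A D)) := by
  have := (hA.measurable_clippedGrad D).comp
    (show Measurable fun x : OuterState p m × E p => x.1.1 by fun_prop)
  have h2 : Measurable fun x : OuterState p m × E p => ‖x.2‖⁻¹ • x.2 :=
    measurable_snd.norm.inv.smul measurable_snd
  unfold enterInner
  simp only [Function.uncurry_def]
  simp only [Function.comp_def] at this
  fun_prop

theorem outerBody_eq (A : Params 𝒟 p m) (D : Multiset 𝒟) (s : OuterState p m) :
    outerBody A D s =
      (gaussian (clippedGrad A D s.1) (A.Cgrad ^ 2 / (2 * s.2.2.1))).bind fun g' =>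
        (innerLoop A D (enterInner A D s g')).bind fun t => Measure.dirac (toOuter t) := rfl

theorem Admissible.measurable_outerBody (hA : Admissible A) (D : Multiset 𝒟) :
    Measurable (outerBody A D) := by
  simp_rw [funext (outerBody_eq A D)]
  have := hA.measurable_clippedGrad D
  refine measurable_bind_param (measurable_gaussian.comp (f := fun s : OuterState p m =>
    (clippedGrad A D s.1, A.Cgrad ^ 2 / (2 * s.2.2.1))) (by fun_prop)) (fun _ => inferInstance) ?_
  exact (Measure.measurable_bind' (Measure.measurable_dirac.comp measurable_toOuter)).comp
    ((hA.measurable_innerLoop D).comp (hA.measurable_enterInner D))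

theorem measurableSet_outerCond (p m : ℕ) :
    MeasurableSet {s : OuterState p m | 0 < s.2.2.2} :=
  measurableSet_lt (by fun_prop) (by fun_prop)

end Measurability

variable {A : Params 𝒟 p m}

/-! ### Output laws from intermediate states -/

section Output

/-- The law of the released weights when the outer loop is started in a given state. -/
def outerOutput (A : Params 𝒟 p m) (D : Multiset 𝒟) (s : OuterState p m) : Measure (E p) :=
  (whileLoop (fun s : OuterState p m => 0 < s.2.2.2) (outerBody A D) s).map Prod.fst

/-- The law of the released weights when the algorithm is continued from a state of the inner
loop. -/
def innerOutput (A : Params 𝒟 p m) (D : Multiset 𝒟) (s : InnerState p m) : Measure (E p) :=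
  (innerLoop A D s).bind fun t => outerOutput A D (toOuter t)

theorem dpAGD_eq (A : Params 𝒟 p m) (ρ : ℝ) (D : Multiset 𝒟) :
    dpAGD A ρ D = outerOutput A D (A.w₀, [], A.ρng, ρ) := rfl

theorem Admissible.measurable_outerOutput (hA : Admissible A) (D : Multiset 𝒟) :
    Measurable (outerOutput A D) :=
  (Measure.measurable_map _ measurable_fst).comp
    (measurable_whileLoop (measurableSet_outerCond p m) (hA.measurable_outerBody D))

theorem Admissible.measurable_innerOutput (hA : Admissible A) (D : Multiset 𝒟) :
    Measurable (innerOutput A D) :=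
  (Measure.measurable_bind' ((hA.measurable_outerOutput D).comp measurable_toOuter)).comp
    (hA.measurable_innerLoop D)

theorem outerOutput_of_nonpos (A : Params 𝒟 p m) (D : Multiset 𝒟) (w : E p) (h : History m)
    (ρng : ℝ) {ρ : ℝ} (hρ : ρ ≤ 0) :
    outerOutput A D (w, h, ρng, ρ) = Measure.dirac w := by
  rw [outerOutput, whileLoop_of_not (by simpa using hρ), Measure.map_dirac' measurable_fst]

theorem Admissible.outerOutput_of_pos (hA : Admissible A) (D : Multiset 𝒟) {s : OuterState p m}
    (hs : 0 < s.2.2.2) :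
    outerOutput A D s =
      (gaussian (clippedGrad A D s.1) (A.Cgrad ^ 2 / (2 * s.2.2.1))).bind fun g' =>
        innerOutput A D (enterInner A D s g') := by
  have hW := measurable_whileLoop (measurableSet_outerCond p m) (hA.measurable_outerBody D)
  have hfst : Measurable fun s : OuterState p m => Measure.dirac s.1 :=
    Measure.measurable_dirac.comp measurable_fst
  have hto : Measurable fun t : InnerState p m => Measure.dirac (toOuter t) :=
    Measure.measurable_dirac.comp measurable_toOuter
  have hO (s : OuterState p m) : outerOutput A D s =
      (whileLoop (fun s : OuterState p m => 0 < s.2.2.2) (outerBody A D) s).bind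
        fun s => Measure.dirac s.1 := (Measure.bind_dirac_eq_map _ measurable_fst).symm
  have hin : Measurable fun g' : E p => innerLoop A D (enterInner A D s g') :=
    (hA.measurable_innerLoop D).comp ((hA.measurable_enterInner D).comp measurable_prodMk_left)
  have hbind : Measurable fun g' : E p => (innerLoop A D (enterInner A D s g')).bind fun t =>
      Measure.dirac (toOuter t) := (Measure.measurable_bind' hto).comp hin
  rw [hO, whileLoop_of (measurableSet_outerCond p m) (hA.measurable_outerBody D) hs,
    Measure.bind_bind hW.aemeasurable hfst.aemeasurable]
  simp_rw [← hO]
  rw [outerBody_eq, Measure.bind_bind hbind.aemeasurable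
    (hA.measurable_outerOutput D).aemeasurable]
  congr 1 with g' : 1
  rw [Measure.bind_bind hto.aemeasurable (hA.measurable_outerOutput D).aemeasurable]
  simp_rw [Measure.dirac_bind (hA.measurable_outerOutput D)]
  rfl

theorem innerLoop_eq (A : Params 𝒟 p m) (D : Multiset 𝒟) :
    innerLoop A D =
      whileLoop (fun s : InnerState p m => s.2.2.2.2.2.2 = 0) (innerBody A D) := rfl

theorem Admissible.innerOutput_of_ne_zero (hA : Admissible A) (D : Multiset 𝒟)
    {s : InnerState p m} (hs : s.2.2.2.2.2.2 ≠ 0) :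
    innerOutput A D s = outerOutput A D (toOuter s) := by
  rw [innerOutput, innerLoop_eq, whileLoop_of_not (by exact hs)]
  exact Measure.dirac_bind ((hA.measurable_outerOutput D).comp measurable_toOuter) s

/-- Associativity of `bind` puts one selection in front of the output law of the continued run, the
form in which composition is applied. -/
theorem Admissible.innerOutput_of_eq_zero (hA : Admissible A) (D : Multiset 𝒟)
    {s : InnerState p m} (hs : s.2.2.2.2.2.2 = 0) :
    innerOutput A D s =
      (noisyMax (scores A D s) A.Cobj (√(2 * A.ρnmax))).bind fun i =>
        (afterSelection A s i).bind (innerOutput A D) := by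
  have hcomp : Measurable fun t => outerOutput A D (toOuter t) :=
    (hA.measurable_outerOutput D).comp measurable_toOuter
  rw [innerOutput, innerLoop_eq,
    whileLoop_of (measurableSet_innerCond p m) (hA.measurable_innerBody D) hs,
    ← innerLoop_eq, Measure.bind_bind (hA.measurable_innerLoop D).aemeasurable hcomp.aemeasurable,
    innerBody_eq]
  exact Measure.bind_bind (measurable_afterSelection_right A s).aemeasurable
    (hA.measurable_innerOutput D).aemeasurable

theorem afterSelection_of_pos (A : Params 𝒟 p m) (w : E p) (h : History m) (g g' : E p)
    (ρng : ℝ) {ρ : ℝ} (i₀ : Fin (m + 1)) {i : Fin (m + 1)} (hi : 0 < i) (hρ : 0 < ρ - A.ρnmax) :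
    afterSelection A (w, h, g, g', ρng, ρ, i₀) i =
      Measure.dirac (w - A.Φ h i • g', h ++ [i], g, g', ρng, ρ - A.ρnmax, i) := by
  simp [afterSelection, hi, hρ]

theorem afterSelection_of_pos_of_nonpos (A : Params 𝒟 p m) (w : E p) (h : History m) (g g' : E p)
    (ρng : ℝ) {ρ : ℝ} (i₀ : Fin (m + 1)) {i : Fin (m + 1)} (hi : 0 < i) (hρ : ρ - A.ρnmax ≤ 0) :
    afterSelection A (w, h, g, g', ρng, ρ, i₀) i =
      Measure.dirac (w, h, g, g', ρng, ρ - A.ρnmax, i) := by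
  simp only [afterSelection, hi, hρ.not_gt, if_true, if_false]

theorem afterSelection_zero (A : Params 𝒟 p m) (w : E p) (h : History m) (g g' : E p)
    (ρng ρ : ℝ) (i₀ : Fin (m + 1)) :
    afterSelection A (w, h, g, g', ρng, ρ, i₀) 0 =
      (gradAvg ρng ((1 + A.γ) * ρng) g g' A.Cgrad).bind fun g'₁ =>
        Measure.dirac (w, h, g, g'₁, (1 + A.γ) * ρng,
          ρ - A.ρnmax - ((1 + A.γ) * ρng - ρng), 0) := by
  simp only [afterSelection, lt_irrefl, if_false]

/-- A property of the next state holds almost surely after the selection of an index if it holds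
in each of the three branches. -/
theorem ae_afterSelection {q : InnerState p m → Prop} (hq : MeasurableSet {t | q t}) {w : E p}
    {h : History m} {g g' : E p} {ρng ρ : ℝ} {i₀ i : Fin (m + 1)}
    (h1 : 0 < i → 0 < ρ - A.ρnmax →
      q (w - A.Φ h i • g', h ++ [i], g, g', ρng, ρ - A.ρnmax, i))
    (h2 : 0 < i → ρ - A.ρnmax ≤ 0 → q (w, h, g, g', ρng, ρ - A.ρnmax, i))
    (h3 : i = 0 → ∀ g'₁, q (w, h, g, g'₁, (1 + A.γ) * ρng,
      ρ - A.ρnmax - ((1 + A.γ) * ρng - ρng), 0)) :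
    ∀ᵐ t ∂afterSelection A (w, h, g, g', ρng, ρ, i₀) i, q t := by
  rcases eq_or_ne i 0 with rfl | hi
  · rw [afterSelection_zero]
    refine ae_bind_of_forall (Measure.measurable_dirac.comp (by fun_prop)) hq
      (ae_of_all _ fun g'₁ => ?_)
    rw [Function.comp_apply, ae_dirac_iff hq]
    exact h3 rfl g'₁
  · have hi' : 0 < i := Fin.pos_of_ne_zero hi
    rcases lt_or_ge 0 (ρ - A.ρnmax) with hρ | hρ
    · rw [afterSelection_of_pos A _ _ _ _ _ _ hi' hρ, ae_dirac_iff hq]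
      exact h1 hi' hρ
    · rw [afterSelection_of_pos_of_nonpos A _ _ _ _ _ _ hi' hρ, ae_dirac_iff hq]
      exact h2 hi' hρ

theorem isProbabilityMeasure_afterSelection (A : Params 𝒟 p m) (s : InnerState p m)
    (i : Fin (m + 1)) : IsProbabilityMeasure (afterSelection A s i) := by
  obtain ⟨w, h, g, g', ρng, ρ, i₀⟩ := s
  rcases eq_or_ne i 0 with rfl | hi
  · rw [afterSelection_zero]
    exact isProbabilityMeasure_bind (Measure.measurable_dirac.comp (by fun_prop))
      fun _ => inferInstanceAs (IsProbabilityMeasure (Measure.dirac _))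
  · have hi' : 0 < i := Fin.pos_of_ne_zero hi
    rcases lt_or_ge 0 (ρ - A.ρnmax) with hρ | hρ
    · rw [afterSelection_of_pos A _ _ _ _ _ _ hi' hρ]; infer_instance
    · rw [afterSelection_of_pos_of_nonpos A _ _ _ _ _ _ hi' hρ]; infer_instance

/-- The inner loop terminates almost surely from every state. -/
theorem Admissible.isProbabilityMeasure_innerLoop (hA : Admissible A) (D : Multiset 𝒟)
    (s : InnerState p m) : IsProbabilityMeasure (innerLoop A D s) := by
  -- All scores lie in `[-card D * Cobj, 0]`, so `κ` is uniform over states.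
  obtain ⟨κ, hκ, hle⟩ := exists_noisyMax_zero_le hA.one_le hA.Cobj_pos hA.sqrt_pos
    (Multiset.card D * A.Cobj)
  refine isProbabilityMeasure_whileLoop (measurableSet_innerCond p m) (hA.measurable_innerBody D)
    (fun s => ?_) hκ (fun s _ => ?_) s
  · have := hA.isProbabilityMeasure_noisyMax (scores A D s)
    rw [innerBody_eq]
    exact isProbabilityMeasure_bind (measurable_afterSelection_right A s)
      (isProbabilityMeasure_afterSelection A s)
  · refine le_trans ?_ (hle (scores A D s) fun j k => ?_)
    · change innerBody A D s {t | t.2.2.2.2.2.2 = 0} ≤ _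
      rw [innerBody_eq, Measure.bind_apply (measurableSet_innerCond p m)
        (measurable_afterSelection_right A s).aemeasurable,
        ← lintegral_indicator_one (measurableSet_singleton _)]
      refine lintegral_mono fun i => ?_
      have := isProbabilityMeasure_afterSelection A s i
      rcases eq_or_ne i 0 with rfl | hi
      · simpa using prob_le_one
      · have hzero : ∀ᵐ t ∂afterSelection A s i, ¬ t.2.2.2.2.2.2 = 0 :=
          ae_afterSelection (measurableSet_innerCond p m).compl (fun _ _ => hi) (fun _ _ => hi)
            fun h => absurd h hi
        rw [ae_iff] at hzero
        simp only [not_not] at hzero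
        rw [hzero]
        exact zero_le
    · have h1 := hA.clippedObj_mem_Icc D (s.1 - A.Φ s.2.1 j • s.2.2.2.1)
      have h2 := hA.clippedObj_mem_Icc D (s.1 - A.Φ s.2.1 k • s.2.2.2.1)
      simp only [scores]
      linarith [h1.1, h2.2]

/-- Once the budget does not exceed the cost of one selection, the weights no longer change. -/
theorem Admissible.innerOutput_of_le (hA : Admissible A) (D : Multiset 𝒟) (w : E p)
    (h : History m) (g g' : E p) {ρng ρ : ℝ} (hρng : 0 < ρng) (hρ : ρ ≤ A.ρnmax) :
    innerOutput A D (w, h, g, g', ρng, ρ, 0) = Measure.dirac w := by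
  -- The last clause is vacuous while the loop runs; at its exit it says that the outer loop stops
  -- at once. Positivity of the gradient budget ensures that averaging only lowers the remaining
  -- budget.
  let q : InnerState p m → Prop := fun s =>
    s.1 = w ∧ 0 < s.2.2.2.2.1 ∧ s.2.2.2.2.2.1 ≤ A.ρnmax ∧
      (s.2.2.2.2.2.2 ≠ 0 → s.2.2.2.2.2.1 ≤ 0)
  have hq : MeasurableSet {s | q s} := by
    have h1 : MeasurableSet {s : InnerState p m | s.1 = w} :=
      measurable_fst (measurableSet_singleton w)
    have h2 : MeasurableSet {s : InnerState p m | 0 < s.2.2.2.2.1} :=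
      measurableSet_lt (by fun_prop) (by fun_prop)
    have h3 : MeasurableSet {s : InnerState p m | s.2.2.2.2.2.1 ≤ A.ρnmax} :=
      measurableSet_le (by fun_prop) (by fun_prop)
    have : {s : InnerState p m | s.2.2.2.2.2.2 ≠ 0 → s.2.2.2.2.2.1 ≤ 0} =
        {s | s.2.2.2.2.2.2 = 0} ∪ {s | s.2.2.2.2.2.1 ≤ 0} := by
      ext s
      simp only [Set.mem_union, Set.mem_ofPred_eq]
      tauto
    have h4 : MeasurableSet {s : InnerState p m | s.2.2.2.2.2.2 ≠ 0 → s.2.2.2.2.2.1 ≤ 0} :=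
      this ▸ (measurableSet_innerCond p m).union (measurableSet_le (by fun_prop) (by fun_prop))
    exact h1.inter (h2.inter (h3.inter h4))
  have hinv : ∀ s, q s → s.2.2.2.2.2.2 = 0 → ∀ᵐ t ∂innerBody A D s, q t := by
    rintro ⟨w', h, g, g', ρng, ρ, i⟩ ⟨hw, hng, hle, -⟩ -
    simp only at hw hng hle
    rw [innerBody_eq]
    refine ae_bind_of_forall (measurable_afterSelection_right A _) hq (ae_of_all _ fun i => ?_)
    refine ae_afterSelection hq (fun _ h1 => absurd h1 (by linarith))
      (fun _ h1 => ⟨hw, hng, ?_, fun _ => h1⟩) (fun _ g'₁ => ⟨hw, ?_, ?_, fun h => absurd rfl h⟩)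
    · simp only
      linarith [hA.ρnmax_pos]
    · exact mul_pos (by linarith [hA.γ_pos]) hng
    · simp only
      nlinarith [mul_pos hA.γ_pos hng, hA.ρnmax_pos]
  have := hA.isProbabilityMeasure_innerLoop D (w, h, g, g', ρng, ρ, 0)
  refine bind_eq_of_forall_eq ?_
  filter_upwards [ae_whileLoop (measurableSet_innerCond p m) (hA.measurable_innerBody D) hq hinv
    (s := (w, h, g, g', ρng, ρ, 0)) ⟨rfl, hρng, hρ, fun h => absurd rfl h⟩] with t ht
  rw [toOuter, outerOutput_of_nonpos A D _ _ _ (ht.1.2.2.2 ht.2), ht.1.1]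

end Output

/-! ### Privacy by induction on the remaining budget -/

section Privacy

/-- Two probability measures with a Rényi bound. -/
structure RenyiClose {Y : Type*} [MeasurableSpace Y] (α ρ : ℝ) (P Q : Measure Y) : Prop where
  left : IsProbabilityMeasure P
  right : IsProbabilityMeasure Q
  bound : RenyiBound α ρ P Q

theorem RenyiClose.bind {X Y : Type*} [MeasurableSpace X] [MeasurableSpace Y] {α a b : ℝ}
    {P Q : Measure Y} {K K' : Y → Measure X} (hα : 1 < α) (h : RenyiClose α a P Q)
    (hK : Measurable K) (hK' : Measurable K') (hKK' : ∀ y, RenyiClose α b (K y) (K' y)) :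
    RenyiClose α (a + b) (P.bind K) (Q.bind K') :=
  have := h.left
  have := h.right
  ⟨isProbabilityMeasure_bind hK fun y => (hKK' y).left,
    isProbabilityMeasure_bind hK' fun y => (hKK' y).right,
    h.bound.bind hα hK hK' fun y => (hKK' y).bound⟩

theorem RenyiClose.dirac {Y : Type*} [MeasurableSpace Y] {α ρ : ℝ} (hα : 1 < α) (hρ : 0 ≤ ρ)
    (y : Y) : RenyiClose α ρ (Measure.dirac y) (Measure.dirac y) :=
  ⟨inferInstance, inferInstance, RenyiBound.refl hα hρ _⟩

theorem renyiClose_gaussian {α : ℝ} (hα : 1 < α) {C ρ : ℝ} (hC : 0 < C) (hρ : 0 < ρ)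
    {g₁ g₂ : E p} (hg : ‖g₁ - g₂‖ ≤ C) :
    RenyiClose α ρ (gaussian g₁ (C ^ 2 / (2 * ρ))) (gaussian g₂ (C ^ 2 / (2 * ρ))) := by
  refine ⟨inferInstance, inferInstance,
    (renyiBound_gaussian hα g₁ g₂ (by positivity)).mono hα ?_⟩
  rw [div_le_iff₀ (by positivity)]
  have : ‖g₁ - g₂‖ ^ 2 ≤ C ^ 2 := pow_le_pow_left₀ (norm_nonneg _) hg 2
  calc ‖g₁ - g₂‖ ^ 2 ≤ C ^ 2 := this
    _ = ρ * (2 * (C ^ 2 / (2 * ρ))) := by field_simp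

/-- Only the fresh measurement sees the data; averaging with the common earlier estimate `g'` is
post-processing. -/
theorem renyiClose_gradAvg {α : ℝ} (hα : 1 < α) {C ρold ρH : ℝ} (hC : 0 < C) (hρ : ρold < ρH)
    {g₁ g₂ : E p} (g' : E p) (hg : ‖g₁ - g₂‖ ≤ C) :
    RenyiClose α (ρH - ρold) (gradAvg ρold ρH g₁ g' C) (gradAvg ρold ρH g₂ g' C) :=
  ⟨inferInstance, inferInstance,
    (renyiClose_gaussian hα hC (sub_pos.2 hρ) hg).bound.map (by fun_prop)⟩

theorem Admissible.renyiClose_noisyMax (hA : Admissible A) {α : ℝ} (hα : 1 < α)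
    {D D' : Multiset 𝒟} (hD : SensitivityBound A D D') {s s' : InnerState p m}
    (h1 : s.1 = s'.1) (h2 : s.2.1 = s'.2.1) (h3 : s.2.2.2.1 = s'.2.2.2.1) :
    RenyiClose α A.ρnmax (noisyMax (scores A D s) A.Cobj (√(2 * A.ρnmax)))
      (noisyMax (scores A D' s') A.Cobj (√(2 * A.ρnmax))) := by
  refine ⟨hA.isProbabilityMeasure_noisyMax _, hA.isProbabilityMeasure_noisyMax _, ?_⟩
  have h := renyiBound_noisyMax (v := scores A D s) (v' := scores A D' s') hα hA.Cobj_pos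
    hA.sqrt_pos fun j k => ?_
  · rwa [Real.sq_sqrt (by linarith [hA.ρnmax_pos]), mul_div_cancel_left₀ _ two_ne_zero] at h
  · have := hD.obj (s.1 - A.Φ s.2.1 k • s.2.2.2.1) (s.1 - A.Φ s.2.1 j • s.2.2.2.1)
    simp only [scores, ← h1, ← h2, ← h3]
    convert this using 2
    ring

/-- One pass through the inner loop, given bounds for the remaining executions. -/
theorem Admissible.renyiClose_innerOutput (hA : Admissible A) {α : ℝ} (hα : 1 < α)
    {D D' : Multiset 𝒟} (hD : SensitivityBound A D D') {b : ℝ}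
    (hO : ∀ w h ρng ρ, 0 < ρng → ρ ≤ b →
      RenyiClose α (max ρ 0) (outerOutput A D (w, h, ρng, ρ)) (outerOutput A D' (w, h, ρng, ρ)))
    (hI : ∀ w h g₁ g₂ g' ρng ρ, ‖g₁ - g₂‖ ≤ A.Cgrad → 0 < ρng → ρ ≤ b →
      RenyiClose α (max ρ 0) (innerOutput A D (w, h, g₁, g', ρng, ρ, 0))
        (innerOutput A D' (w, h, g₂, g', ρng, ρ, 0)))
    (w : E p) (h : History m) (g₁ g₂ g' : E p) (ρng ρ : ℝ) (hg : ‖g₁ - g₂‖ ≤ A.Cgrad)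
    (hρng : 0 < ρng) (hρ : ρ ≤ b + A.ρnmax) :
    RenyiClose α (max ρ 0) (innerOutput A D (w, h, g₁, g', ρng, ρ, 0))
      (innerOutput A D' (w, h, g₂, g', ρng, ρ, 0)) := by
  -- The selection cannot be afforded here, but both outputs are the same point mass.
  rcases le_or_gt ρ A.ρnmax with hle | hgt
  · rw [hA.innerOutput_of_le D _ _ _ _ hρng hle, hA.innerOutput_of_le D' _ _ _ _ hρng hle]
    exact RenyiClose.dirac hα (le_max_right _ _) _
  have hρ₁ : 0 < ρ - A.ρnmax := sub_pos.2 hgt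
  have hbind (D) (s) : Measurable fun i => (afterSelection A s i).bind (innerOutput A D) :=
    (Measure.measurable_bind' (hA.measurable_innerOutput D)).comp
      (measurable_afterSelection_right A s)
  rw [max_eq_left (by linarith [hA.ρnmax_pos]), hA.innerOutput_of_eq_zero D rfl,
    hA.innerOutput_of_eq_zero D' rfl, ← add_sub_cancel A.ρnmax ρ]
  refine (hA.renyiClose_noisyMax hα hD rfl rfl rfl).bind hα (hbind _ _) (hbind _ _) fun i => ?_
  rw [add_sub_cancel]
  rcases eq_or_ne i 0 with rfl | hi
  · have hlt : ρng < (1 + A.γ) * ρng := by nlinarith [mul_pos hA.γ_pos hρng]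
    have hstate (g : E p) : Measurable fun g'₁ : E p =>
        ((w, h, g, g'₁, (1 + A.γ) * ρng, ρ - A.ρnmax - ((1 + A.γ) * ρng - ρng), 0) :
          InnerState p m) := by fun_prop
    have hdirac (g : E p) : Measurable fun g'₁ : E p =>
        Measure.dirac ((w, h, g, g'₁, (1 + A.γ) * ρng, ρ - A.ρnmax - ((1 + A.γ) * ρng - ρng), 0) :
          InnerState p m) := Measure.measurable_dirac.comp (hstate g)
    rw [afterSelection_zero, afterSelection_zero,
      Measure.bind_bind (hdirac _).aemeasurable (hA.measurable_innerOutput D).aemeasurable,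
      Measure.bind_bind (hdirac _).aemeasurable
        (hA.measurable_innerOutput D').aemeasurable]
    simp_rw [Measure.dirac_bind (hA.measurable_innerOutput _)]
    -- If averaging overdraws the budget, its nominal cost must not be charged: the continuation
    -- does not depend on the new estimate, so the measurement integrates out.
    rcases le_or_gt (ρ - A.ρnmax - ((1 + A.γ) * ρng - ρng)) 0 with h2 | h2
    · rw [bind_eq_of_forall_eq (ae_of_all _ fun g'₁ => hA.innerOutput_of_le D w h g₁ g'₁
          (hρng.trans hlt) (h2.trans hA.ρnmax_pos.le)),
        bind_eq_of_forall_eq (ae_of_all _ fun g'₁ => hA.innerOutput_of_le D' w h g₂ g'₁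
          (hρng.trans hlt) (h2.trans hA.ρnmax_pos.le))]
      exact RenyiClose.dirac hα hρ₁.le _
    · have hb := (renyiClose_gradAvg hα hA.Cgrad_pos hlt g' hg).bind hα
        ((hA.measurable_innerOutput D).comp (hstate g₁))
        ((hA.measurable_innerOutput D').comp (hstate g₂))
        fun g'₁ => hI w h g₁ g₂ g'₁ _ _ hg (hρng.trans hlt) (by linarith)
      rwa [max_eq_left h2.le, add_sub_cancel] at hb
  · have hi' : 0 < i := Fin.pos_of_ne_zero hi
    rw [afterSelection_of_pos A _ _ _ _ _ _ hi' hρ₁, afterSelection_of_pos A _ _ _ _ _ _ hi' hρ₁,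
      Measure.dirac_bind (hA.measurable_innerOutput _),
      Measure.dirac_bind (hA.measurable_innerOutput _), hA.innerOutput_of_ne_zero D hi,
      hA.innerOutput_of_ne_zero D' hi]
    have hb := hO (w - A.Φ h i • g') (h ++ [i]) ρng (ρ - A.ρnmax) hρng (by linarith)
    rwa [max_eq_left hρ₁.le] at hb

/-- One pass through the outer loop, given bounds for the inner loop. -/
theorem Admissible.renyiClose_outerOutput (hA : Admissible A) {α : ℝ} (hα : 1 < α)
    {D D' : Multiset 𝒟} (hD : SensitivityBound A D D') {b : ℝ}
    (hI : ∀ w h g₁ g₂ g' ρng ρ, ‖g₁ - g₂‖ ≤ A.Cgrad → 0 < ρng → ρ ≤ b →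
      RenyiClose α (max ρ 0) (innerOutput A D (w, h, g₁, g', ρng, ρ, 0))
        (innerOutput A D' (w, h, g₂, g', ρng, ρ, 0)))
    (w : E p) (h : History m) (ρng ρ : ℝ) (hρng : 0 < ρng) (hρ : ρ ≤ b) :
    RenyiClose α (max ρ 0) (outerOutput A D (w, h, ρng, ρ))
      (outerOutput A D' (w, h, ρng, ρ)) := by
  rcases le_or_gt ρ 0 with hle | hpos
  · rw [outerOutput_of_nonpos A D _ _ _ hle, outerOutput_of_nonpos A D' _ _ _ hle]
    exact RenyiClose.dirac hα (le_max_right _ _) _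
  rw [max_eq_left hpos.le, hA.outerOutput_of_pos D hpos, hA.outerOutput_of_pos D' hpos]
  -- As for averaging, an unaffordable gradient measurement has no influence on the output.
  rcases le_or_gt (ρ - ρng) 0 with h2 | h2
  · have hdirac (D g') : innerOutput A D (enterInner A D (w, h, ρng, ρ) g') = Measure.dirac w :=
      hA.innerOutput_of_le D w h _ _ hρng (h2.trans hA.ρnmax_pos.le)
    rw [bind_eq_of_forall_eq (ae_of_all _ (hdirac D)),
      bind_eq_of_forall_eq (ae_of_all _ (hdirac D'))]
    exact RenyiClose.dirac hα hpos.le _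
  · have hmeas (D) : Measurable fun g' => innerOutput A D (enterInner A D (w, h, ρng, ρ) g') :=
      (hA.measurable_innerOutput D).comp
        ((hA.measurable_enterInner D).comp measurable_prodMk_left)
    have hb := (renyiClose_gaussian hα hA.Cgrad_pos hρng (hD.grad w)).bind hα (hmeas D) (hmeas D')
      fun g' => hI w h _ _ (‖g'‖⁻¹ • g') ρng (ρ - ρng) (hD.grad w) hρng (by linarith)
    rwa [max_eq_left h2.le, add_sub_cancel] at hb

/-- The induction counts multiples of `ρnmax`, because every selection spends that much while
gradient costs need no lower bound. At stage `n + 1` the inner claim uses both claims at `n`, and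
the outer claim uses the inner one at `n + 1`. The exact gradients `g₁`, `g₂` may differ between the
runs; the noisy estimate `g'` is common. -/
theorem Admissible.renyiClose_output (hA : Admissible A) {α : ℝ} (hα : 1 < α)
    {D D' : Multiset 𝒟} (hD : SensitivityBound A D D') (n : ℕ) :
    (∀ w h ρng ρ, 0 < ρng → ρ ≤ n * A.ρnmax →
      RenyiClose α (max ρ 0) (outerOutput A D (w, h, ρng, ρ))
        (outerOutput A D' (w, h, ρng, ρ))) ∧
    ∀ w h g₁ g₂ g' ρng ρ, ‖g₁ - g₂‖ ≤ A.Cgrad → 0 < ρng → ρ ≤ n * A.ρnmax →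
      RenyiClose α (max ρ 0) (innerOutput A D (w, h, g₁, g', ρng, ρ, 0))
        (innerOutput A D' (w, h, g₂, g', ρng, ρ, 0)) := by
  induction n with
  | zero =>
    rw [Nat.cast_zero, zero_mul]
    refine ⟨fun w h ρng ρ _ hle => ?_, fun w h g₁ g₂ g' ρng ρ _ hρng hle => ?_⟩
    · rw [outerOutput_of_nonpos A D _ _ _ hle, outerOutput_of_nonpos A D' _ _ _ hle]
      exact RenyiClose.dirac hα (le_max_right _ _) _
    · rw [hA.innerOutput_of_le D _ _ _ _ hρng (hle.trans hA.ρnmax_pos.le),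
        hA.innerOutput_of_le D' _ _ _ _ hρng (hle.trans hA.ρnmax_pos.le)]
      exact RenyiClose.dirac hα (le_max_right _ _) _
  | succ n ih =>
    rw [Nat.cast_succ, add_one_mul]
    have hI := hA.renyiClose_innerOutput hα hD ih.1 ih.2
    exact ⟨hA.renyiClose_outerOutput hα hD hI, hI⟩

theorem Admissible.renyiClose_dpAGD (hA : Admissible A) (hρng : 0 < A.ρng) {ρ : ℝ} (hρ : 0 ≤ ρ)
    {α : ℝ} (hα : 1 < α) {D D' : Multiset 𝒟} (hD : SensitivityBound A D D') :
    RenyiClose α ρ (dpAGD A ρ D) (dpAGD A ρ D') := by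
  obtain ⟨n, hn⟩ := exists_nat_ge (ρ / A.ρnmax)
  have := (hA.renyiClose_output hα hD n).1 A.w₀ [] A.ρng ρ hρng
    ((div_le_iff₀ hA.ρnmax_pos).1 hn)
  rwa [max_eq_left hρ] at this

end Privacy

end DPAGD

end

/-! ### The privacy theorem -/

theorem mainTheorem1 {𝒟 : Type*} {p m : ℕ} (A : DPAGD.Params 𝒟 p m)
    (hm : 1 ≤ m)
    (hloss : ∀ d, Measurable (A.loss d))
    (hloss_nonneg : ∀ d w, 0 ≤ A.loss d w)
    (hgrad_meas : ∀ d, Measurable (A.grad d))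
    (hgrad : ∀ d w, DifferentiableAt ℝ (A.loss d) w → HasGradientAt (A.loss d) (A.grad d w) w)
    (hρnmax : 0 < A.ρnmax) (hρng : 0 < A.ρng) (hγ : 0 < A.γ)
    (hCobj : 0 < A.Cobj) (hCgrad : 0 < A.Cgrad)
    (εtot δtot ρ : ℝ) (hδ : 0 < δtot) (hρ : 0 ≤ ρ)
    (hconv : ρ + 2 * √(ρ * Real.log (1 / δtot)) ≤ εtot) :
    (∀ D, MeasureTheory.IsProbabilityMeasure (DPAGD.dpAGD A ρ D)) ∧
      DPAGD.IsZCDP (DPAGD.dpAGD A ρ) ρ ∧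
      DPAGD.IsDP (DPAGD.dpAGD A ρ) εtot δtot := by
  have hA : DPAGD.Admissible A :=
    ⟨hm, hloss, hloss_nonneg, hgrad_meas, hρnmax, hγ, hCobj, hCgrad⟩
  have hprob (D) : MeasureTheory.IsProbabilityMeasure (DPAGD.dpAGD A ρ D) :=
    (hA.renyiClose_dpAGD hρng hρ one_lt_two (hA.sensitivityBound_self D)).left
  have hbound {D D'} (h : DPAGD.Neighbor D D') (α : ℝ) (hα : 1 < α) :
      DPAGD.RenyiBound α ρ (DPAGD.dpAGD A ρ D) (DPAGD.dpAGD A ρ D') :=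
    (hA.renyiClose_dpAGD hρng hρ hα (hA.sensitivityBound h)).bound
  refine ⟨hprob, fun D D' h => ⟨(hbound h 2 one_lt_two).absolutelyContinuous one_lt_two,
    fun α hα => (hbound h α hα).lintegral_rnDeriv_rpow_le hα⟩, fun D D' h S hS => ?_⟩
  -- The order chosen in the conversion has `ρ` in the denominator. For `ρ = 0` the loop never
  -- starts, both outputs are the point mass at `w₀`, and `εtot ≥ 0` suffices.
  rcases hρ.eq_or_lt with rfl | hpos
  · rw [DPAGD.dpAGD_eq, DPAGD.dpAGD_eq, DPAGD.outerOutput_of_nonpos A D _ _ _ le_rfl,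
      DPAGD.outerOutput_of_nonpos A D' _ _ _ le_rfl]
    refine le_trans (le_mul_of_one_le_left zero_le ?_) le_self_add
    simpa using hconv
  · exact DPAGD.measure_le_of_renyiBound (hbound h) hδ hpos hconv hS
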